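/- Let $\Sigma$ be a smooth three-manifold, $\mathcal I\subset\mathbb R$ an open interval and $\lambda\in\mathbb R$. Let $\{\beta_t,\mathfrak e^t=(e^t_u,e^t_l,e^t_n)\}_{t\in\mathcal I}$ be a smooth family of strictly positive functions and coframes on $\Sigma$, and set $$h_t=e^t_u\otimes e^t_u+e^t_l\otimes e^t_l+e^t_n\otimes e^t_n,\qquad \Theta_t=-\frac1{2\beta_t}\,\partial_t h_t .$$ For a one-form $\alpha$ on $\Sigma$, write $\Theta_t(\alpha)=\Theta_t(\alpha^{\sharp},\cdot)$ and $\mathrm d\beta_t(\alpha)=\mathrm d\beta_t(\alpha^\sharp)$, where $\alpha^\sharp$ is the $h_t$-dual vector field. Suppose that $\{\beta_t,\mathfrak e^t\}_{t\in\mathcal I}$ is a real Killing spinorial flow, that is, for all $t\in\mathcal I$: $$\partial_t e^t_u+\mathrm d\beta_t(e^t_u)\,e^t_u+\beta_t\Theta_t(e^t_u)=\mathrm d\beta_t+\lambda\beta_t e^t_l,\qquad \partial_t e^t_l+\beta_t\Theta_t(e^t_l)=-(\mathrm d\beta_t(e^t_l)+\lambda\beta_t)\,e^t_u,$$ $$\partial_t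 e^t_n+\beta_t\Theta_t(e^t_n)=-\mathrm d\beta_t(e^t_n)\,e^t_u,\qquad \partial_t(\Theta_t(e^t_u))+\lambda\,\partial_t e^t_l=-\mathrm d(\mathrm d\beta_t(e^t_u)),$$ $$\mathrm d e^t_u=(\Theta_t(e^t_u)-\lambda e^t_l)\wedge e^t_u,\qquad \mathrm d e^t_l=\Theta_t(e^t_l)\wedge e^t_u,\qquad \mathrm d e^t_n+\lambda e^t_l\wedge e^t_n=\Theta_t(e^t_n)\wedge e^t_u,$$ and the one-form $\Theta_t(e^t_u)+\lambda e^t_l$ is exact on $\Sigma$. Then there is a smooth family of functions $\{\mathfrak f_t\}_{t\in\mathcal I}$ on $\Sigma$ such that $$\mathrm d\mathfrak f_t=-\Theta_t(e^t_u)-\lambda e^t_l,\qquad \partial_t\mathfrak f_t=\mathrm d\beta_t(e^t_u),$$ and for every such family the Ricci tensor of the Lorentzian metric $g=-\beta_t^2\,\mathrm dt\otimes\mathrm dt+h_t$ on $M=\mathcal I\times\Sigma$ is $$\mathrm{Ric}^g=-3\lambda^2 g+\tfrac12\,H\,e^{-2\mathfrak f_t}\,u\otimes u,$$ where $u=e^{\mathfrak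 f_t}(\beta_t\,\mathrm dt+e^t_u)$ and $H(t,p)=\big(\mathrm R_{h_t}-|\Theta_t|^2_{h_t}+\mathrm{Tr}_{h_t}(\Theta_t)^2+6\lambda^2\big)\big|_p$, with $\mathrm R_{h_t}$ the scalar curvature of $h_t$. -/

import Mathlib

open scoped Manifold ContDiff
open Bundle Set

noncomputable section

namespace KillingFlow

/-! ### Curvature of a (pseudo-Riemannian) metric in coordinates

`b` is a basis of the vector space `E` and `G x i j` are the components of a metric tensor on an
open set of `E` in the linear coordinates defined by `b`. -/

section Coordinates

variable {E : Type*} [NormedAddCommGroup E] [NormedSpace ℝ E]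
  {ι : Type*} [Fintype ι] [DecidableEq ι] (b : Module.Basis ι ℝ E)

/-- The partial derivative `∂_i f` at `x`. -/
def partialD (i : ι) (f : E → ℝ) (x : E) : ℝ :=
  fderiv ℝ f x (b i)

/-- The Christoffel symbols
`Γ^k_ij = ½ ∑_l G^kl (∂_i G_jl + ∂_j G_il - ∂_l G_ij)`. -/
def christoffel (G : E → Matrix ι ι ℝ) (k i j : ι) (x : E) : ℝ :=
  1 / 2 * ∑ l, (G x)⁻¹ k l *
    (partialD b i (fun y => G y j l) x + partialD b j (fun y => G y i l) x
      - partialD b l (fun y => G y i j) x)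

/-- The components
`Ric_ij = ∑_k (∂_k Γ^k_ij - ∂_i Γ^k_kj + ∑_l (Γ^k_kl Γ^l_ij - Γ^k_il Γ^l_kj))`
of the Ricci tensor `Ric(v,w) = tr (u ↦ R(u,v)w)`. -/
def ricciCoord (G : E → Matrix ι ι ℝ) (i j : ι) (x : E) : ℝ :=
  ∑ k, (partialD b k (christoffel b G k i j) x - partialD b i (christoffel b G k k j) x
    + ∑ l, (christoffel b G k k l x * christoffel b G l i j x
      - christoffel b G k i l x * christoffel b G l k j x))

/-- The scalar curvature `∑_ij G^ij Ric_ij`. -/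
def scalarCoord (G : E → Matrix ι ι ℝ) (x : E) : ℝ :=
  ∑ i, ∑ j, (G x)⁻¹ i j * ricciCoord b G i j x

end Coordinates

/-! ### Tensors on a manifold -/

section Manifold

variable {E : Type*} [NormedAddCommGroup E] [NormedSpace ℝ E] {H : Type*} [TopologicalSpace H]
  (I : ModelWithCorners ℝ E H) {M : Type*} [TopologicalSpace M] [ChartedSpace H M]

/-- The differential at the point of coordinates `x` of the inverse of the preferred chart
at `p`. -/
def chartSymmDeriv (p : M) (x : E) : E →L[ℝ] TangentSpace I ((extChartAt I p).symm x) :=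
  mfderiv 𝓘(ℝ, E) I (extChartAt I p).symm x

/-- The differential at `p` of the preferred chart at `p`. -/
def chartDeriv (p : M) : TangentSpace I p →L[ℝ] E :=
  mfderiv I 𝓘(ℝ, E) (extChartAt I p) p

/-- The exterior derivative of a one-form: `dα(v,w) = ∂_v (α(w)) - ∂_w (α(v))` for vector fields
`v`, `w` that are constant in the preferred chart at `p`. -/
def extD (α : ∀ q : M, TangentSpace I q →L[ℝ] ℝ) (p : M) (v w : TangentSpace I p) : ℝ :=
  fderiv ℝ (fun x => α ((extChartAt I p).symm x) (chartSymmDeriv I p x (chartDeriv I p w)))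
      (extChartAt I p p) (chartDeriv I p v)
    - fderiv ℝ (fun x => α ((extChartAt I p).symm x) (chartSymmDeriv I p x (chartDeriv I p v)))
      (extChartAt I p p) (chartDeriv I p w)

variable {ι : Type*} [Fintype ι] [DecidableEq ι] (b : Module.Basis ι ℝ E)

/-- The components of a bilinear form in the preferred chart at `p`. -/
def metricInChart (g : ∀ q : M, TangentSpace I q →L[ℝ] TangentSpace I q →L[ℝ] ℝ) (p : M) (x : E) :
    Matrix ι ι ℝ :=
  Matrix.of fun i j => g ((extChartAt I p).symm x) (chartSymmDeriv I p x (b i))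
    (chartSymmDeriv I p x (b j))

/-- The Ricci tensor of a metric `g`, computed at each point `p` in the preferred chart at `p`
(and in the linear coordinates of the model space defined by `b`, on which it does not depend). -/
def ricci (g : ∀ q : M, TangentSpace I q →L[ℝ] TangentSpace I q →L[ℝ] ℝ) (p : M)
    (v w : TangentSpace I p) : ℝ :=
  ∑ i, ∑ j, b.repr (chartDeriv I p v) i * b.repr (chartDeriv I p w) j
    * ricciCoord b (metricInChart I b g p) i j (extChartAt I p p)

/-- The scalar curvature of a metric `g`, computed at `p` in the preferred chart at `p`. -/
def scalarCurv (g : ∀ q : M, TangentSpace I q →L[ℝ] TangentSpace I q →L[ℝ] ℝ) (p : M) : ℝ :=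
  scalarCoord b (metricInChart I b g p) (extChartAt I p p)

variable {I}

/-- The wedge product of two covectors. -/
def wedge {p : M} (α γ : TangentSpace I p →L[ℝ] ℝ) (v w : TangentSpace I p) : ℝ :=
  α v * γ w - α w * γ v

/-- The tensor product of two covectors. -/
def tensor {p : M} (α γ : TangentSpace I p →L[ℝ] ℝ) :
    TangentSpace I p →L[ℝ] TangentSpace I p →L[ℝ] ℝ :=
  α.smulRight γ

/-- The vector metrically dual to a covector. -/
def sharp {p : M} (h : TangentSpace I p →L[ℝ] TangentSpace I p →L[ℝ] ℝ)
    (α : TangentSpace I p →L[ℝ] ℝ) : TangentSpace I p :=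
  h.inverse α

/-- The trace of a bilinear form with respect to a metric. -/
def traceWrt {p : M} (h B : TangentSpace I p →L[ℝ] TangentSpace I p →L[ℝ] ℝ) : ℝ :=
  LinearMap.trace ℝ (TangentSpace I p) (h.inverse ∘L B : TangentSpace I p →L[ℝ] TangentSpace I p)

/-- The squared norm `B_ij B^ij` of a symmetric bilinear form with respect to a metric. -/
def normSqWrt {p : M} (h B : TangentSpace I p →L[ℝ] TangentSpace I p →L[ℝ] ℝ) : ℝ :=
  LinearMap.trace ℝ (TangentSpace I p)
    ((h.inverse ∘L B) ∘L (h.inverse ∘L B) : TangentSpace I p →L[ℝ] TangentSpace I p)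

end Manifold

/-- The standard basis of `ℝ³`. -/
def basis3 : Module.Basis (Fin 3) ℝ (EuclideanSpace ℝ (Fin 3)) :=
  (EuclideanSpace.basisFun (Fin 3) ℝ).toBasis

/-- The standard basis of `ℝ × ℝ³`. -/
def basis4 : Module.Basis (Unit ⊕ Fin 3) ℝ (ℝ × EuclideanSpace ℝ (Fin 3)) :=
  (Module.Basis.singleton Unit ℝ).prod basis3

/-! ### Families of functions and coframes on a three-manifold -/

/-- Families `β_t` of functions and `(e_u, e_l, e_n)_t` of triples of one-forms on `S`. -/
structure Family (S : Type*) [TopologicalSpace S] [ChartedSpace (EuclideanSpace ℝ (Fin 3)) S] where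
  β : ℝ → S → ℝ
  eu : ℝ → ∀ p : S, TangentSpace (𝓡 3) p →L[ℝ] ℝ
  el : ℝ → ∀ p : S, TangentSpace (𝓡 3) p →L[ℝ] ℝ
  en : ℝ → ∀ p : S, TangentSpace (𝓡 3) p →L[ℝ] ℝ

variable {S : Type*} [TopologicalSpace S] [ChartedSpace (EuclideanSpace ℝ (Fin 3)) S]

namespace Family

variable (F : Family S)

/-- The metric `h_t = e_u ⊗ e_u + e_l ⊗ e_l + e_n ⊗ e_n`. -/
def h (t : ℝ) (p : S) : TangentSpace (𝓡 3) p →L[ℝ] TangentSpace (𝓡 3) p →L[ℝ] ℝ :=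
  tensor (F.eu t p) (F.eu t p) + tensor (F.el t p) (F.el t p) + tensor (F.en t p) (F.en t p)

/-- The second fundamental form `Θ_t = -(1 / (2 β_t)) ∂_t h_t`. -/
def Θ (t : ℝ) (p : S) : TangentSpace (𝓡 3) p →L[ℝ] TangentSpace (𝓡 3) p →L[ℝ] ℝ :=
  (-(1 / (2 * F.β t p))) • deriv (fun s => F.h s p) t

/-- The covector `Θ_t(α) = Θ_t(α^♯, ·)`. -/
def ΘOf (t : ℝ) (p : S) (α : TangentSpace (𝓡 3) p →L[ℝ] ℝ) : TangentSpace (𝓡 3) p →L[ℝ] ℝ :=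
  F.Θ t p (sharp (F.h t p) α)

/-- The covector `dβ_t`. -/
def dβ (t : ℝ) (p : S) : TangentSpace (𝓡 3) p →L[ℝ] ℝ :=
  mvfderiv (𝓡 3) (F.β t) p

/-- The number `dβ_t(α) = dβ_t(α^♯)`. -/
def dβOf (t : ℝ) (p : S) (α : TangentSpace (𝓡 3) p →L[ℝ] ℝ) : ℝ :=
  F.dβ t p (sharp (F.h t p) α)

/-- The Hamiltonian function `R_{h_t} - |Θ_t|² + (Tr Θ_t)² + 6 λ²`. -/
def hamiltonian (lam t : ℝ) (p : S) : ℝ :=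
  scalarCurv (𝓡 3) basis3 (F.h t) p - normSqWrt (F.h t p) (F.Θ t p)
    + traceWrt (F.h t p) (F.Θ t p) ^ 2 + 6 * lam ^ 2

/-- The one-form `dt` on `ℝ × S`. -/
def dt (q : ℝ × S) : TangentSpace (𝓘(ℝ, ℝ).prod (𝓡 3)) q →L[ℝ] ℝ :=
  mvfderiv (𝓘(ℝ, ℝ).prod (𝓡 3)) (Prod.fst : ℝ × S → ℝ) q

/-- The pullback to `(t, p) ∈ ℝ × S` of a covector of `S` at `p`. -/
def lift (q : ℝ × S) (α : TangentSpace (𝓡 3) q.2 →L[ℝ] ℝ) :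
    TangentSpace (𝓘(ℝ, ℝ).prod (𝓡 3)) q →L[ℝ] ℝ :=
  α ∘L mfderiv (𝓘(ℝ, ℝ).prod (𝓡 3)) (𝓡 3) (Prod.snd : ℝ × S → S) q

/-- The Lorentzian metric `g = -β_t² dt ⊗ dt + h_t`. -/
def g (q : ℝ × S) : TangentSpace (𝓘(ℝ, ℝ).prod (𝓡 3)) q →L[ℝ]
    TangentSpace (𝓘(ℝ, ℝ).prod (𝓡 3)) q →L[ℝ] ℝ :=
  (-(F.β q.1 q.2 ^ 2)) • tensor (dt q) (dt q)
    + tensor (lift q (F.eu q.1 q.2)) (lift q (F.eu q.1 q.2))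
    + tensor (lift q (F.el q.1 q.2)) (lift q (F.el q.1 q.2))
    + tensor (lift q (F.en q.1 q.2)) (lift q (F.en q.1 q.2))

/-- The one-form `u = e^{f_t} (β_t dt + e_u^t)`. -/
def u (f : ℝ → S → ℝ) (q : ℝ × S) : TangentSpace (𝓘(ℝ, ℝ).prod (𝓡 3)) q →L[ℝ] ℝ :=
  Real.exp (f q.1 q.2) • (F.β q.1 q.2 • dt q + lift q (F.eu q.1 q.2))

end Family

/-- Joint smoothness on `J × S` of a family `(α_t)` of one-forms. -/
def SmoothOneForms [IsManifold (𝓡 3) ∞ S] (J : Set ℝ)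
    (α : ℝ → ∀ p : S, TangentSpace (𝓡 3) p →L[ℝ] ℝ) : Prop :=
  ContMDiffOn (𝓘(ℝ, ℝ).prod (𝓡 3)) ((𝓡 3).prod 𝓘(ℝ, EuclideanSpace ℝ (Fin 3) →L[ℝ] ℝ)) ∞
    (fun q : ℝ × S => TotalSpace.mk' (EuclideanSpace ℝ (Fin 3) →L[ℝ] ℝ)
      (E := fun p : S => TangentSpace (𝓡 3) p →L[ℝ] ℝ) q.2 (α q.1 q.2)) (J ×ˢ univ)

/-- Joint smoothness on `J × S` of a family `(f_t)` of functions. -/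
def SmoothFunctions (J : Set ℝ) (f : ℝ → S → ℝ) : Prop :=
  ContMDiffOn (𝓘(ℝ, ℝ).prod (𝓡 3)) 𝓘(ℝ, ℝ) ∞ (fun q : ℝ × S => f q.1 q.2) (J ×ˢ univ)

/-- The family `(β_t, e^t)_{t ∈ J}` is a real Killing spinorial flow with Killing constant `lam`:
a smooth family of positive functions and of coframes satisfying the real Killing spinorial flow
equations. Only `t ∈ J` matters. -/
structure IsKillingSpinorialFlow [IsManifold (𝓡 3) ∞ S] (lam : ℝ) (J : Set ℝ) (F : Family S) :
    Prop where
  smooth_β : SmoothFunctions J F.β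
  smooth_eu : SmoothOneForms J F.eu
  smooth_el : SmoothOneForms J F.el
  smooth_en : SmoothOneForms J F.en
  β_pos : ∀ t ∈ J, ∀ p, 0 < F.β t p
  coframe : ∀ t ∈ J, ∀ p, LinearIndependent ℝ ![F.eu t p, F.el t p, F.en t p]
  evol_eu : ∀ t ∈ J, ∀ p,
    deriv (fun s => F.eu s p) t + F.dβOf t p (F.eu t p) • F.eu t p
      + F.β t p • F.ΘOf t p (F.eu t p) = F.dβ t p + (lam * F.β t p) • F.el t p
  evol_el : ∀ t ∈ J, ∀ p,
    deriv (fun s => F.el s p) t + F.β t p • F.ΘOf t p (F.el t p)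
      = (-(F.dβOf t p (F.el t p) + lam * F.β t p)) • F.eu t p
  evol_en : ∀ t ∈ J, ∀ p,
    deriv (fun s => F.en s p) t + F.β t p • F.ΘOf t p (F.en t p)
      = (-(F.dβOf t p (F.en t p))) • F.eu t p
  evol_Θ : ∀ t ∈ J, ∀ p,
    deriv (fun s => F.ΘOf s p (F.eu s p)) t + lam • deriv (fun s => F.el s p) t
      = -(mvfderiv (𝓡 3) (fun q => F.dβOf t q (F.eu t q)) p)
  d_eu : ∀ t ∈ J, ∀ p, ∀ v w : TangentSpace (𝓡 3) p,
    extD (𝓡 3) (F.eu t) p v w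
      = wedge (F.ΘOf t p (F.eu t p) - lam • F.el t p) (F.eu t p) v w
  d_el : ∀ t ∈ J, ∀ p, ∀ v w : TangentSpace (𝓡 3) p,
    extD (𝓡 3) (F.el t) p v w = wedge (F.ΘOf t p (F.el t p)) (F.eu t p) v w
  d_en : ∀ t ∈ J, ∀ p, ∀ v w : TangentSpace (𝓡 3) p,
    extD (𝓡 3) (F.en t) p v w + lam * wedge (F.el t p) (F.en t p) v w
      = wedge (F.ΘOf t p (F.en t p)) (F.eu t p) v w
  exact_form : ∀ t ∈ J, ∃ φ : S → ℝ, ContMDiff (𝓡 3) 𝓘(ℝ, ℝ) ∞ φ ∧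
    ∀ p, mvfderiv (𝓡 3) φ p = F.ΘOf t p (F.eu t p) + lam • F.el t p

/-- The family of functions `(f_t)_{t ∈ J}` is smooth and satisfies
`d f_t = -Θ_t(e_u^t) - λ e_l^t` and `∂_t f_t = dβ_t(e_u^t)`. -/
structure IsPotential (lam : ℝ) (J : Set ℝ) (F : Family S) (f : ℝ → S → ℝ) : Prop where
  smooth : SmoothFunctions J f
  d_space : ∀ t ∈ J, ∀ p,
    mvfderiv (𝓡 3) (f t) p = -F.ΘOf t p (F.eu t p) - lam • F.el t p
  d_time : ∀ t ∈ J, ∀ p, deriv (fun s => f s p) t = F.dβOf t p (F.eu t p)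

end KillingFlow

end

/-!
Complete the coframe of the slices by `β dt` to an orthonormal coframe of the spacetime. Its
connection forms can be read off from the flow equations, and the resulting curvature forms are
those of constant curvature `-λ²`, except for the two that pair `e_l` and `e_n` with `β dt`, which
have the same excess as those that pair `e_l` and `e_n` with `e_u`. By the first Bianchi identity
the two excesses are divisible by `β dt + e_u`, so their trace, the excess of the Ricci tensor, is a
multiple of `u ⊗ u`. The Gauss equation of a slice identifies the coefficient with half the
Hamiltonian function.

For the potential, choose primitives of the exact forms `-Θ_t(e_u) - λ e_l` at one base time in each
component of the set of times and integrate `dβ_t(e_u)` from there: the evolution equation of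
`Θ_t(e_u)` is the closedness of `dβ_t(e_u) dt - Θ_t(e_u) - λ e_l`.
-/

noncomputable section

open scoped Topology

namespace KillingFlow

/-! ### Dual frames -/

section DualFrames

variable {E : Type*} [NormedAddCommGroup E] [NormedSpace ℝ E] {ι : Type*} [Fintype ι]
  [DecidableEq ι]

/-- The covectors `e` form a coframe and the vectors `X` form the frame dual to it. -/
structure IsDualFrame (e : ι → E →L[ℝ] ℝ) (X : ι → E) : Prop where
  apply_eq : ∀ a c, e a (X c) = if a = c then 1 else 0
  sum_smul : ∀ v, ∑ a, e a v • X a = v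

/-- The metric for which the coframe `e` is orthonormal. -/
def coframeMetric (e : ι → E →L[ℝ] ℝ) : E →L[ℝ] E →L[ℝ] ℝ :=
  ∑ a, (e a).smulRight (e a)

/-- The metric on covectors for which the evaluations at the vectors of the frame `X` are
orthonormal, as a map from covectors to vectors: the inverse of the metric of the coframe dual
to `X`. -/
def frameCometric (X : ι → E) : (E →L[ℝ] ℝ) →L[ℝ] E :=
  ∑ a, (ContinuousLinearMap.apply ℝ ℝ (X a)).smulRight (X a)

omit [DecidableEq ι] in
theorem coframeMetric_apply (e : ι → E →L[ℝ] ℝ) (v w : E) :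
    coframeMetric e v w = ∑ a, e a v * e a w := by
  simp [coframeMetric]

omit [DecidableEq ι] in
theorem frameCometric_apply (X : ι → E) (φ : E →L[ℝ] ℝ) :
    frameCometric X φ = ∑ a, φ (X a) • X a := by
  simp [frameCometric]

namespace IsDualFrame

variable {e : ι → E →L[ℝ] ℝ} {X : ι → E}

theorem of_finrank_eq_card [FiniteDimensional ℝ E] (hE : Module.finrank ℝ E = Fintype.card ι)
    (he : ∀ a c, e a (X c) = if a = c then 1 else 0) : IsDualFrame e X where
  apply_eq := he
  sum_smul v := by
    have hX : LinearIndependent ℝ X := Fintype.linearIndependent_iff.2 fun g hg a => by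
      simpa [he] using congrArg (e a) hg
    let b := Module.Basis.mk hX (hX.span_eq_top_of_card_eq_finrank' hE.symm).ge
    have hb (a : ι) : b a = X a := Module.Basis.mk_apply _ _ a
    rw [← b.sum_repr v]
    simp [hb, he]

variable (h : IsDualFrame e X)
include h

/-- The basis formed by the vectors of a frame. -/
def basis : Module.Basis ι ℝ E :=
  .ofEquivFun
    { toFun v a := e a v
      invFun r := ∑ a, r a • X a
      left_inv := h.sum_smul
      right_inv r := by ext a; simp [h.apply_eq]
      map_add' v w := by ext a; simp
      map_smul' r v := by ext a; simp }

theorem basis_apply (a : ι) : h.basis a = X a := by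
  simp [basis]

theorem basis_repr (v : E) (a : ι) : h.basis.repr v a = e a v :=
  rfl

theorem covector_eq_sum (φ : E →L[ℝ] ℝ) (v : E) : φ v = ∑ a, φ (X a) * e a v := by
  conv_lhs => rw [← h.sum_smul v]
  simp [mul_comm]

theorem coframeMetric_comp_frameCometric :
    coframeMetric e ∘L frameCometric X = ContinuousLinearMap.id ℝ (E →L[ℝ] ℝ) := by
  ext φ v
  simp [coframeMetric_apply, frameCometric_apply, h.apply_eq, h.covector_eq_sum φ v]

theorem frameCometric_comp_coframeMetric :
    frameCometric X ∘L coframeMetric e = ContinuousLinearMap.id ℝ E := by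
  ext v
  simp [coframeMetric_apply, frameCometric_apply, h.apply_eq, h.sum_smul v]

theorem isInvertible_coframeMetric : (coframeMetric e).IsInvertible :=
  .of_inverse h.coframeMetric_comp_frameCometric h.frameCometric_comp_coframeMetric

theorem inverse_coframeMetric : (coframeMetric e).inverse = frameCometric X :=
  ContinuousLinearMap.inverse_eq h.coframeMetric_comp_frameCometric
    h.frameCometric_comp_coframeMetric

theorem inverse_coframeMetric_coframe (a : ι) : (coframeMetric e).inverse (e a) = X a := by
  simp [h.inverse_coframeMetric, frameCometric_apply, h.apply_eq]

theorem trace_eq_sum (L : E →ₗ[ℝ] E) : LinearMap.trace ℝ E L = ∑ a, e a (L (X a)) := by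
  simp [LinearMap.trace_eq_matrix_trace ℝ h.basis, Matrix.trace, LinearMap.toMatrix_apply,
    h.basis_apply, h.basis_repr]

theorem trace_inverse_comp (B : E →L[ℝ] E →L[ℝ] ℝ) :
    LinearMap.trace ℝ E ((coframeMetric e).inverse ∘L B : E →L[ℝ] E) = ∑ a, B (X a) (X a) := by
  simp [h.trace_eq_sum, h.inverse_coframeMetric, frameCometric_apply, h.apply_eq]

theorem trace_inverse_comp_sq (B : E →L[ℝ] E →L[ℝ] ℝ) :
    LinearMap.trace ℝ E (((coframeMetric e).inverse ∘L B) ∘L ((coframeMetric e).inverse ∘L B)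
      : E →L[ℝ] E) = ∑ a, ∑ c, B (X a) (X c) * B (X c) (X a) := by
  simp [h.trace_eq_sum, h.inverse_coframeMetric, frameCometric_apply, h.apply_eq]

end IsDualFrame

theorem exists_isDualFrame_of_linearIndependent [FiniteDimensional ℝ E] {e : ι → E →L[ℝ] ℝ}
    (he : LinearIndependent ℝ e) (hE : Module.finrank ℝ E = Fintype.card ι) :
    ∃ X : ι → E, IsDualFrame e X := by
  have he' : LinearIndependent ℝ fun a => (e a : Module.Dual ℝ E) :=
    he.map' (ContinuousLinearMap.coeLM ℝ)
      (LinearMap.ker_eq_bot.2 ContinuousLinearMap.coe_injective)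
  let b := Module.Basis.mk he'
    (he'.span_eq_top_of_card_eq_finrank' (hE.symm.trans Subspace.dual_finrank_eq.symm)).ge
  refine ⟨fun c => (Module.evalEquiv ℝ E).symm (b.dualBasis c),
    .of_finrank_eq_card hE fun a c => ?_⟩
  have hb : b a = (e a : Module.Dual ℝ E) := Module.Basis.mk_apply _ _ a
  calc e a ((Module.evalEquiv ℝ E).symm (b.dualBasis c))
      = b.dualBasis c (e a) :=
        Module.apply_evalEquiv_symm_apply ℝ E (e a : Module.Dual ℝ E) (b.dualBasis c)
    _ = if a = c then 1 else 0 := by rw [← hb, Module.Basis.dualBasis_apply_self]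

variable {e : ι → ℝ → E →L[ℝ] ℝ} {e' : ι → E →L[ℝ] ℝ} {t : ℝ}

set_option synthInstance.maxHeartbeats 200000 in
-- The norm on the bilinear forms of a general normed space is slow to infer.
omit [DecidableEq ι] in
theorem hasDerivAt_coframeMetric (he : ∀ a, HasDerivAt (e a) (e' a) t) :
    HasDerivAt (fun s => coframeMetric fun a => e a s)
      (∑ a, ((e a t).smulRight (e' a) + (e' a).smulRight (e a t))) t := by
  have hsum := HasDerivAt.fun_sum (F := E →L[ℝ] E →L[ℝ] ℝ) (u := Finset.univ)
    (A := fun a s => (e a s).smulRight (e a s)) fun a _ =>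
      ContinuousLinearMap.hasDerivAt_of_bilinear (G := E →L[ℝ] E →L[ℝ] ℝ)
        (B := ContinuousLinearMap.smulRightL ℝ E (E →L[ℝ] ℝ)) (fun _ => he a) (fun _ => he a)
  exact hsum

set_option synthInstance.maxHeartbeats 200000 in
-- The norm on the bilinear forms of a general normed space is slow to infer.
omit [DecidableEq ι] in
theorem deriv_coframeMetric_apply (he : ∀ a, HasDerivAt (e a) (e' a) t) (v w : E) :
    deriv (fun s => coframeMetric fun a => e a s) t v w
      = ∑ a, (e a t v * e' a w + e' a v * e a t w) := by
  have hderiv : deriv (fun s => coframeMetric fun a => e a s) t = _ :=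
    HasDerivAt.deriv (𝕜 := ℝ) (F := E →L[ℝ] E →L[ℝ] ℝ) (hasDerivAt_coframeMetric he)
  simp [hderiv]

variable {Y : Type*} [NormedAddCommGroup Y] [NormedSpace ℝ Y] {U : Set Y} {n : ℕ∞ω}
  {θ : ι → Y → E →L[ℝ] ℝ} {X : ι → Y → E}

omit [DecidableEq ι] in
theorem contDiffOn_coframeMetric (hθ : ∀ a, ContDiffOn ℝ n (θ a) U) :
    ContDiffOn ℝ n (fun y => coframeMetric fun a => θ a y) U :=
  ContDiffOn.sum (F := E →L[ℝ] E →L[ℝ] ℝ) fun a _ => (hθ a).smulRight (hθ a)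

theorem contDiffOn_dualFrame (hθ : ∀ a, ContDiffOn ℝ n (θ a) U)
    (hX : ∀ y ∈ U, IsDualFrame (fun a => θ a y) (fun a => X a y)) (a : ι) :
    ContDiffOn ℝ n (X a) U := by
  have hinv : ContDiffOn ℝ n (fun y => (coframeMetric fun a => θ a y).inverse) U := fun y hy =>
    have := Module.Finite.of_basis (hX y hy).basis
    have := FiniteDimensional.complete ℝ E
    ContDiffAt.comp_contDiffWithinAt (F := E →L[ℝ] E →L[ℝ] ℝ) (G := (E →L[ℝ] ℝ) →L[ℝ] E)
      (g := ContinuousLinearMap.inverse) y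
      (hX y hy).isInvertible_coframeMetric.contDiffAt_map_inverse
      (contDiffOn_coframeMetric hθ y hy)
  exact (hinv.clm_apply (hθ a)).congr fun y hy =>
    ((hX y hy).inverse_coframeMetric_coframe a).symm

end DualFrames

/-! ### Moving frames -/

section MovingFrames

variable {E : Type*} [NormedAddCommGroup E] [NormedSpace ℝ E]

/-- The wedge product of two covectors of a normed space, as a continuous bilinear form. -/
def wedgeProd (α γ : E →L[ℝ] ℝ) : E →L[ℝ] E →L[ℝ] ℝ :=
  α.smulRight γ - γ.smulRight α

@[simp]
theorem wedgeProd_apply (α γ : E →L[ℝ] ℝ) (v w : E) :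
    wedgeProd α γ v w = α v * γ w - α w * γ v := by
  simp [wedgeProd, mul_comm]

/-- The exterior derivative of a one-form on a normed space. -/
def dForm (α : E → E →L[ℝ] ℝ) (x : E) : E →L[ℝ] E →L[ℝ] ℝ :=
  fderiv ℝ α x - (fderiv ℝ α x).flip

theorem dForm_apply (α : E → E →L[ℝ] ℝ) (x v w : E) :
    dForm α x v w = fderiv ℝ α x v w - fderiv ℝ α x w v :=
  rfl

theorem dForm_congr {α γ : E → E →L[ℝ] ℝ} {x : E} (h : α =ᶠ[𝓝 x] γ) : dForm α x = dForm γ x := by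
  rw [dForm, dForm, h.fderiv_eq]

theorem dForm_add {α γ : E → E →L[ℝ] ℝ} {x : E} (hα : DifferentiableAt ℝ α x)
    (hγ : DifferentiableAt ℝ γ x) : dForm (fun y => α y + γ y) x = dForm α x + dForm γ x := by
  ext v w
  simp only [dForm_apply, fderiv_fun_add hα hγ, add_apply]
  ring

theorem dForm_const_smul (r : ℝ) (α : E → E →L[ℝ] ℝ) (x : E) :
    dForm (fun y => r • α y) x = r • dForm α x := by
  have hr : fderiv ℝ (fun y => r • α y) x = r • fderiv ℝ α x :=
    congrFun (fderiv_const_smul_field (𝕜 := ℝ) (f := α) r) x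
  ext v w
  simp [dForm_apply, hr, mul_sub]

theorem dForm_sub {α γ : E → E →L[ℝ] ℝ} {x : E} (hα : DifferentiableAt ℝ α x)
    (hγ : DifferentiableAt ℝ γ x) : dForm (fun y => α y - γ y) x = dForm α x - dForm γ x := by
  ext v w
  simp only [dForm_apply, fderiv_fun_sub hα hγ, sub_apply]
  ring

theorem dForm_neg (α : E → E →L[ℝ] ℝ) (x : E) : dForm (fun y => -α y) x = -dForm α x := by
  ext v w
  simp only [dForm_apply, fderiv_fun_neg, neg_apply]
  ring

theorem dForm_fderiv {f : E → ℝ} {x : E} (hf : ContDiffAt ℝ 2 f x) :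
    dForm (fderiv ℝ f) x = 0 := by
  ext v w
  rw [dForm_apply, (hf.isSymmSndFDerivAt (by simp)) v w, sub_self, zero_apply, zero_apply]

theorem fderiv_apply_const {F G : Type*} [NormedAddCommGroup F] [NormedSpace ℝ F]
    [NormedAddCommGroup G] [NormedSpace ℝ G] {A : E → F →L[ℝ] G} {x : E}
    (h : DifferentiableAt ℝ A x) (u : E) (v : F) :
    fderiv ℝ (fun y => A y v) x u = fderiv ℝ A x u v := by
  simp [fderiv_clm_apply h (differentiableAt_const v)]

theorem sum_repr_mul_apply {ι : Type*} [Fintype ι] (b : Module.Basis ι ℝ E) (φ : E →L[ℝ] ℝ)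
    (v : E) : ∑ i, b.repr v i * φ (b i) = φ v := by
  conv_rhs => rw [← b.sum_repr v]
  simp only [map_sum, map_smul, smul_eq_mul]

variable {κ : Type*} [Fintype κ] (θ : κ → E → E →L[ℝ] ℝ) (ψ : κ → κ → E → E →L[ℝ] ℝ)

/-- The curvature form `Ω^a_c = dψ^a_c + ∑_d ψ^a_d ∧ ψ^d_c` of a matrix of connection forms. -/
def curvForm (a c : κ) (x : E) : E →L[ℝ] E →L[ℝ] ℝ :=
  dForm (ψ a c) x + ∑ d, wedgeProd (ψ a d x) (ψ d c x)

theorem curvForm_apply (a c : κ) (x v w : E) :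
    curvForm ψ a c x v w
      = dForm (ψ a c) x v w + ∑ d, (ψ a d x v * ψ d c x w - ψ a d x w * ψ d c x v) := by
  simp [curvForm]

theorem curvForm_swap (a c : κ) (x v w : E) :
    curvForm ψ a c x v w = -curvForm ψ a c x w v := by
  simp only [curvForm_apply, dForm_apply, Finset.sum_sub_distrib]
  ring

/-- The difference `Ω^a_c - K θ^a ∧ (ε_c θ^c)` between a curvature form and the one that a metric
`∑_a ε_a θ^a ⊗ θ^a` of constant sectional curvature `K` would have. -/
def excessForm (K : ℝ) (ε : κ → ℝ) (a c : κ) (x : E) : E →L[ℝ] E →L[ℝ] ℝ :=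
  curvForm ψ a c x - (K * ε c) • wedgeProd (θ a x) (θ c x)

theorem excessForm_apply (K : ℝ) (ε : κ → ℝ) (a c : κ) (x v w : E) :
    excessForm θ ψ K ε a c x v w
      = curvForm ψ a c x v w - K * ε c * (θ a x v * θ c x w - θ a x w * θ c x v) := by
  simp [excessForm]

theorem excessForm_swap (K : ℝ) (ε : κ → ℝ) (a c : κ) (x v w : E) :
    excessForm θ ψ K ε a c x v w = -excessForm θ ψ K ε a c x w v := by
  rw [excessForm_apply, excessForm_apply, curvForm_swap]
  ring

/-- The component `θ^a(∇_v w)` of the covariant derivative of the constant vector field `w`, for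
the connection with connection forms `ψ` in the coframe `θ`. -/
def nabla (a : κ) (x v w : E) : ℝ :=
  fderiv ℝ (θ a) x v w + ∑ c, ψ a c x v * θ c x w

/-- The component `θ^a(∇_u ∇_v w)` of the second covariant derivative of the constant vector field
`w`, for constant vector fields `u` and `v`. -/
def nablaNabla (a : κ) (x u v w : E) : ℝ :=
  fderiv ℝ (fun y => nabla θ ψ a y v w) x u + ∑ c, ψ a c x u * nabla θ ψ c x v w

variable {θ ψ} {x : E}

theorem differentiableAt_nabla (hθ : ∀ a, ContDiffAt ℝ 2 (θ a) x)
    (hψ : ∀ a c, DifferentiableAt ℝ (ψ a c) x) (a : κ) (v w : E) :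
    DifferentiableAt ℝ (fun y => nabla θ ψ a y v w) x := by
  have hθ' (a : κ) : DifferentiableAt ℝ (θ a) x := (hθ a).differentiableAt (by simp)
  have hdθ : DifferentiableAt ℝ (fderiv ℝ (θ a)) x :=
    ((hθ a).fderiv_right (m := 1) (by norm_num)).differentiableAt (by simp)
  unfold nabla
  fun_prop

theorem fderiv_nabla (hθ : ∀ a, ContDiffAt ℝ 2 (θ a) x)
    (hψ : ∀ a c, DifferentiableAt ℝ (ψ a c) x) (a : κ) (u v w : E) :
    fderiv ℝ (fun y => nabla θ ψ a y v w) x u = fderiv ℝ (fderiv ℝ (θ a)) x u v w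
      + ∑ c, (fderiv ℝ (ψ a c) x u v * θ c x w + ψ a c x v * fderiv ℝ (θ c) x u w) := by
  have hθ' (a : κ) : DifferentiableAt ℝ (θ a) x := (hθ a).differentiableAt (by simp)
  have hdθ : DifferentiableAt ℝ (fderiv ℝ (θ a)) x :=
    ((hθ a).fderiv_right (m := 1) (by norm_num)).differentiableAt (by simp)
  have hψv (c : κ) : DifferentiableAt ℝ (fun y => ψ a c y v) x := by fun_prop
  have hθw (c : κ) : DifferentiableAt ℝ (fun y => θ c y w) x := by fun_prop
  have hdθv : DifferentiableAt ℝ (fun y => fderiv ℝ (θ a) y v) x := by fun_prop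
  unfold nabla
  rw [fderiv_fun_add (by fun_prop) (by fun_prop), fderiv_fun_sum fun c _ => by fun_prop]
  simp only [add_apply, sum_apply, fderiv_fun_mul (hψv _) (hθw _), smul_apply, smul_eq_mul,
    fderiv_apply_const hdθv, fderiv_apply_const hdθ, fderiv_apply_const (hψ a _),
    fderiv_apply_const (hθ' _)]
  exact congrArg _ (Finset.sum_congr rfl fun c _ => by ring)

theorem nablaNabla_sub_nablaNabla (hθ : ∀ a, ContDiffAt ℝ 2 (θ a) x)
    (hψ : ∀ a c, DifferentiableAt ℝ (ψ a c) x) (a : κ) (u v w : E) :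
    nablaNabla θ ψ a x u v w - nablaNabla θ ψ a x v u w
      = ∑ c, curvForm ψ a c x u v * θ c x w := by
  have hψψ (u v : E) : ∑ c, (∑ d, ψ a d x u * ψ d c x v) * θ c x w
      = ∑ c, ψ a c x u * ∑ d, ψ c d x v * θ d x w := by
    simp only [Finset.sum_mul, Finset.mul_sum, ← mul_assoc]
    exact Finset.sum_comm
  rw [nablaNabla, nablaNabla, fderiv_nabla hθ hψ, fderiv_nabla hθ hψ,
    ((hθ a).isSymmSndFDerivAt (by simp)) u v]
  simp only [curvForm_apply, dForm_apply, nabla, mul_add, add_mul, sub_mul,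
    Finset.sum_add_distrib, Finset.sum_sub_distrib, hψψ]
  ring

variable (θ ψ) in
/-- On the open set `U`, the one-forms `ψ` are the connection forms of a torsion-free connection in
the coframe `θ`, that is, they satisfy Cartan's first structure equation. -/
structure IsTorsionFree (U : Set E) : Prop where
  isOpen : IsOpen U
  smooth_θ : ∀ a, ContDiffOn ℝ 2 (θ a) U
  smooth_ψ : ∀ a c, ContDiffOn ℝ 1 (ψ a c) U
  torsion : ∀ y ∈ U, ∀ a, dForm (θ a) y = -∑ c, wedgeProd (ψ a c y) (θ c y)

namespace IsTorsionFree

variable {U : Set E} (h : IsTorsionFree θ ψ U) (hx : x ∈ U)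
include h hx

theorem contDiffAt_θ (a : κ) : ContDiffAt ℝ 2 (θ a) x :=
  (h.smooth_θ a).contDiffAt (h.isOpen.mem_nhds hx)

theorem differentiableAt_θ (a : κ) : DifferentiableAt ℝ (θ a) x :=
  (h.contDiffAt_θ hx a).differentiableAt (by simp)

theorem differentiableAt_ψ (a c : κ) : DifferentiableAt ℝ (ψ a c) x :=
  ((h.smooth_ψ a c).contDiffAt (h.isOpen.mem_nhds hx)).differentiableAt (by simp)

theorem dForm_eq (a : κ) (v w : E) :
    dForm (θ a) x v w = -∑ c, (ψ a c x v * θ c x w - ψ a c x w * θ c x v) := by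
  simp [h.torsion x hx a]

theorem nabla_symm (a : κ) (v w : E) : nabla θ ψ a x v w = nabla θ ψ a x w v := by
  have htorsion := h.dForm_eq hx a v w
  rw [dForm_apply, Finset.sum_sub_distrib] at htorsion
  simp only [nabla]
  linear_combination htorsion

theorem nablaNabla_symm (a : κ) (u v w : E) :
    nablaNabla θ ψ a x u v w = nablaNabla θ ψ a x u w v := by
  have hnear : (fun y => nabla θ ψ a y v w) =ᶠ[𝓝 x] fun y => nabla θ ψ a y w v := by
    filter_upwards [h.isOpen.mem_nhds hx] with y hy using h.nabla_symm hy a v w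
  simp only [nablaNabla, hnear.fderiv_eq, h.nabla_symm hx _ v w]

theorem bianchi (a : κ) (u v w : E) :
    ∑ c, (curvForm ψ a c x u v * θ c x w + curvForm ψ a c x v w * θ c x u
      + curvForm ψ a c x w u * θ c x v) = 0 := by
  have hcurv := nablaNabla_sub_nablaNabla (h.contDiffAt_θ hx) (h.differentiableAt_ψ hx) a
  rw [Finset.sum_add_distrib, Finset.sum_add_distrib, ← hcurv, ← hcurv, ← hcurv,
    h.nablaNabla_symm hx a u v w, h.nablaNabla_symm hx a v w u, h.nablaNabla_symm hx a w u v]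
  ring

theorem excessForm_bianchi (K : ℝ) (ε : κ → ℝ) (a : κ) (u v w : E) :
    ∑ c, (excessForm θ ψ K ε a c x u v * θ c x w + excessForm θ ψ K ε a c x v w * θ c x u
      + excessForm θ ψ K ε a c x w u * θ c x v) = 0 := by
  rw [← h.bianchi hx a u v w]
  simp only [excessForm_apply]
  exact Finset.sum_congr rfl fun c _ => by ring

end IsTorsionFree

variable [DecidableEq κ]

/-- On the open set `U`, the one-forms `ψ` are the Levi-Civita connection forms, in the coframe `θ`
dual to the frame `X`, of the metric `∑_a ε_a θ^a ⊗ θ^a`. -/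
structure IsLeviCivita (ε : κ → ℝ) (θ : κ → E → E →L[ℝ] ℝ) (X : κ → E → E)
    (ψ : κ → κ → E → E →L[ℝ] ℝ) (U : Set E) : Prop extends IsTorsionFree θ ψ U where
  sign : ∀ a, ε a * ε a = 1
  dual : ∀ y ∈ U, IsDualFrame (fun a => θ a y) (fun a => X a y)
  skew : ∀ y ∈ U, ∀ a c, ε a • ψ a c y = -(ε c • ψ c a y)

namespace IsLeviCivita

variable {ε : κ → ℝ} {X : κ → E → E} {U : Set E} (h : IsLeviCivita ε θ X ψ U)
include h

theorem curvForm_skew (hx : x ∈ U) (a c : κ) :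
    ε a • curvForm ψ a c x = -(ε c • curvForm ψ c a x) := by
  have hnear : (fun y => ε a • ψ a c y) =ᶠ[𝓝 x] fun y => -(ε c • ψ c a y) := by
    filter_upwards [h.isOpen.mem_nhds hx] with y hy using h.skew y hy a c
  have hd : ε a • dForm (ψ a c) x = -(ε c • dForm (ψ c a) x) := by
    rw [← dForm_const_smul, ← dForm_const_smul, ← dForm_neg, dForm_congr hnear]
  ext v w
  have hskew (a c : κ) (v : E) : ε a * ψ a c x v = -(ε c * ψ c a x v) :=
    congr($(h.skew x hx a c) v)
  have hdvw : ε a * dForm (ψ a c) x v w = -(ε c * dForm (ψ c a) x v w) := congr($hd v w)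
  simp only [smul_apply, neg_apply, smul_eq_mul, curvForm_apply, mul_add, hdvw, neg_add,
    Finset.mul_sum, ← Finset.sum_neg_distrib]
  refine congrArg _ (Finset.sum_congr rfl fun d _ => ?_)
  linear_combination ψ d c x w * hskew a d v - ψ d c x v * hskew a d w
    - ψ d a x v * hskew d c w + ψ d a x w * hskew d c v

theorem excessForm_skew (hx : x ∈ U) (K : ℝ) (a c : κ) :
    ε a • excessForm θ ψ K ε a c x = -(ε c • excessForm θ ψ K ε c a x) := by
  ext v w
  have hΩ : ε a * curvForm ψ a c x v w = -(ε c * curvForm ψ c a x v w) :=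
    congr($(h.curvForm_skew hx a c) v w)
  simp only [smul_apply, neg_apply, smul_eq_mul, excessForm_apply]
  linear_combination hΩ

theorem sum_curvForm_mul_eq (hx : x ∈ U) (K : ℝ) (v w : E) :
    ∑ a, ∑ c, curvForm ψ a c x (X a x) v * θ c x w
      = K * (Fintype.card κ - 1) * ∑ a, ε a * (θ a x v * θ a x w)
        + ∑ a, ∑ c, excessForm θ ψ K ε a c x (X a x) v * θ c x w := by
  have hΩ (a c : κ) : curvForm ψ a c x (X a x) v * θ c x w
      = K * (ε c * (θ c x v * θ c x w))
        - K * ((if c = a then 1 else 0) * (ε c * (θ a x v * θ c x w)))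
        + excessForm θ ψ K ε a c x (X a x) v * θ c x w := by
    rw [excessForm_apply, (h.dual x hx).apply_eq, (h.dual x hx).apply_eq, if_pos rfl]
    ring
  simp only [hΩ, Finset.sum_add_distrib, Finset.sum_sub_distrib, ← Finset.mul_sum, ite_mul,
    one_mul, zero_mul, Finset.sum_ite_eq', Finset.mem_univ, if_true, Finset.sum_const,
    Finset.card_univ, nsmul_eq_mul]
  ring

theorem contDiffOn_X (a : κ) : ContDiffOn ℝ 2 (X a) U :=
  contDiffOn_dualFrame h.smooth_θ h.dual a

theorem differentiableAt_X (hx : x ∈ U) (a : κ) : DifferentiableAt ℝ (X a) x :=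
  ((h.contDiffOn_X a).contDiffAt (h.isOpen.mem_nhds hx)).differentiableAt (by simp)

variable {ι : Type*} [Fintype ι] [DecidableEq ι] (b : Module.Basis ι ℝ E) {G : E → Matrix ι ι ℝ}
  (hG : ∀ y ∈ U, ∀ i j, G y i j = ∑ a, ε a * (θ a y (b i) * θ a y (b j)))
include hG

theorem inv_metric_apply (hx : x ∈ U) (i j : ι) :
    (G x)⁻¹ i j = ∑ a, ε a * (b.repr (X a x) i * b.repr (X a x) j) := by
  let c := (h.dual x hx).basis
  have hGx : G x = (c.toMatrix b).transpose * Matrix.diagonal ε * c.toMatrix b := by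
    ext i j
    rw [hG x hx, Matrix.mul_apply]
    simp only [Matrix.mul_diagonal, Matrix.transpose_apply,
      Module.Basis.toMatrix_apply, c, IsDualFrame.basis_repr]
    exact Finset.sum_congr rfl fun a _ => by ring
  have hinv : (G x)⁻¹ = b.toMatrix c * Matrix.diagonal ε * (b.toMatrix c).transpose := by
    refine Matrix.inv_eq_right_inv ?_
    calc G x * (b.toMatrix c * Matrix.diagonal ε * (b.toMatrix c).transpose)
        = (c.toMatrix b).transpose * (Matrix.diagonal ε * (c.toMatrix b * b.toMatrix c)
            * Matrix.diagonal ε) * (b.toMatrix c).transpose := by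
          simp only [hGx, Matrix.mul_assoc]
      _ = (b.toMatrix c * c.toMatrix b).transpose := by
          rw [Matrix.transpose_mul]
          simp [Matrix.diagonal_mul_diagonal, h.sign]
      _ = 1 := by simp
  rw [hinv, Matrix.mul_apply]
  simp only [Matrix.mul_diagonal, Matrix.transpose_apply,
    Module.Basis.toMatrix_apply, c, IsDualFrame.basis_apply]
  exact Finset.sum_congr rfl fun a _ => by ring

theorem sum_inv_metric_mul (hx : x ∈ U) (φ : E →L[ℝ] ℝ) (k : ι) :
    ∑ l, (G x)⁻¹ k l * φ (b l) = ∑ a, ε a * (b.repr (X a x) k * φ (X a x)) := by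
  simp only [h.inv_metric_apply b hG hx, Finset.sum_mul]
  rw [Finset.sum_comm]
  refine Finset.sum_congr rfl fun a _ => ?_
  rw [← sum_repr_mul_apply b φ (X a x), Finset.mul_sum, Finset.mul_sum]
  exact Finset.sum_congr rfl fun l _ => by ring

omit [Fintype ι] [DecidableEq ι] in
theorem partialD_metric (hx : x ∈ U) (i j l : ι) :
    partialD b i (fun y => G y j l) x = ∑ a, ε a * (nabla θ ψ a x (b i) (b j) * θ a x (b l)
      + θ a x (b j) * nabla θ ψ a x (b i) (b l)) := by
  have hnear : (fun y => G y j l) =ᶠ[𝓝 x]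
      fun y => ∑ a, ε a * (θ a y (b j) * θ a y (b l)) := by
    filter_upwards [h.isOpen.mem_nhds hx] with y hy using hG y hy j l
  have hθ := h.differentiableAt_θ hx
  have hθv (a : κ) (v : E) : DifferentiableAt ℝ (fun y => θ a y v) x := by fun_prop
  have hskew : ∑ a, ε a * ((∑ c, ψ a c x (b i) * θ c x (b j)) * θ a x (b l))
      = -∑ a, ε a * (θ a x (b j) * ∑ c, ψ a c x (b i) * θ c x (b l)) := by
    simp only [Finset.mul_sum, Finset.sum_mul, ← Finset.sum_neg_distrib]
    rw [Finset.sum_comm]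
    refine Finset.sum_congr rfl fun a _ => Finset.sum_congr rfl fun c _ => ?_
    have hψ : ε c * ψ c a x (b i) = -(ε a * ψ a c x (b i)) := congr($(h.skew x hx c a) (b i))
    linear_combination θ a x (b j) * θ c x (b l) * hψ
  rw [partialD, hnear.fderiv_eq, fderiv_fun_sum fun a _ => by fun_prop]
  simp only [sum_apply, fderiv_const_mul ((hθv _ _).fun_mul (hθv _ _)),
    fderiv_fun_mul (hθv _ _) (hθv _ _), smul_apply, add_apply, smul_eq_mul,
    fderiv_apply_const (hθ _), nabla, mul_add, add_mul, Finset.sum_add_distrib, hskew]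
  simp only [mul_comm (fderiv ℝ (θ _) x _ _)]
  ring

theorem christoffel_eq (hx : x ∈ U) (k i j : ι) :
    christoffel b G k i j x = b.repr (∑ a, nabla θ ψ a x (b i) (b j) • X a x) k := by
  let φ : E →L[ℝ] ℝ := ∑ a, (2 * ε a * nabla θ ψ a x (b i) (b j)) • θ a x
  have hφ (l : ι) : partialD b i (fun y => G y j l) x + partialD b j (fun y => G y i l) x
      - partialD b l (fun y => G y i j) x = φ (b l) := by
    simp only [h.partialD_metric b hG hx, ← Finset.sum_add_distrib, ← Finset.sum_sub_distrib, φ,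
      sum_apply, smul_apply, smul_eq_mul]
    refine Finset.sum_congr rfl fun a _ => ?_
    rw [h.nabla_symm hx a (b j) (b i), h.nabla_symm hx a (b l) (b i),
      h.nabla_symm hx a (b l) (b j)]
    ring
  have hφX (a : κ) : φ (X a x) = 2 * ε a * nabla θ ψ a x (b i) (b j) := by
    simp [φ, (h.dual x hx).apply_eq]
  simp only [christoffel, hφ, h.sum_inv_metric_mul b hG hx, hφX, map_sum, map_smul,
    Finsupp.coe_finsetSum, Finset.sum_apply, Finsupp.smul_apply, smul_eq_mul, Finset.mul_sum]
  refine Finset.sum_congr rfl fun a _ => ?_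
  linear_combination b.repr (X a x) k * nabla θ ψ a x (b i) (b j) * h.sign a

theorem sum_christoffel_eq (hx : x ∈ U) (a : κ) (i j : ι) :
    ∑ k, christoffel b G k i j x * θ a x (b k) = nabla θ ψ a x (b i) (b j) := by
  simp only [h.christoffel_eq b hG hx]
  rw [sum_repr_mul_apply b (θ a x)]
  simp [(h.dual x hx).apply_eq]

theorem differentiableAt_christoffel (hx : x ∈ U) (k i j : ι) :
    DifferentiableAt ℝ (christoffel b G k i j) x := by
  have := Module.Finite.of_basis b
  have hnear : christoffel b G k i j =ᶠ[𝓝 x] fun y =>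
      (b.coord k).toContinuousLinearMap (∑ a, nabla θ ψ a y (b i) (b j) • X a y) := by
    filter_upwards [h.isOpen.mem_nhds hx] with y hy using h.christoffel_eq b hG hy k i j
  have hX := h.differentiableAt_X hx
  have hnabla (a : κ) := differentiableAt_nabla (h.contDiffAt_θ hx) (h.differentiableAt_ψ hx) a
  refine DifferentiableAt.congr_of_eventuallyEq ?_ hnear
  fun_prop

theorem nablaNabla_eq (hx : x ∈ U) (a : κ) (m i j : ι) :
    nablaNabla θ ψ a x (b m) (b i) (b j) = ∑ k, (partialD b m (christoffel b G k i j) x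
      + ∑ l, christoffel b G k m l x * christoffel b G l i j x) * θ a x (b k) := by
  have hnear : (fun y => nabla θ ψ a y (b i) (b j)) =ᶠ[𝓝 x]
      fun y => ∑ k, christoffel b G k i j y * θ a y (b k) := by
    filter_upwards [h.isOpen.mem_nhds hx] with y hy using (h.sum_christoffel_eq b hG hy a i j).symm
  have hθ := h.differentiableAt_θ hx
  have hθv (k : ι) : DifferentiableAt ℝ (fun y => θ a y (b k)) x := by fun_prop
  have hΓ (k : ι) := h.differentiableAt_christoffel b hG hx k i j
  have hψ : ∑ c, ψ a c x (b m) * nabla θ ψ c x (b i) (b j)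
      = ∑ l, christoffel b G l i j x * ∑ c, ψ a c x (b m) * θ c x (b l) := by
    simp only [← h.sum_christoffel_eq b hG hx _ i j, Finset.mul_sum]
    rw [Finset.sum_comm]
    exact Finset.sum_congr rfl fun l _ => Finset.sum_congr rfl fun c _ => by ring
  have hΓΓ : ∑ k, (∑ l, christoffel b G k m l x * christoffel b G l i j x) * θ a x (b k)
      = ∑ l, christoffel b G l i j x * nabla θ ψ a x (b m) (b l) := by
    simp only [← h.sum_christoffel_eq b hG hx a m, Finset.mul_sum, Finset.sum_mul]
    rw [Finset.sum_comm]
    exact Finset.sum_congr rfl fun l _ => Finset.sum_congr rfl fun c _ => by ring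
  rw [nablaNabla, hnear.fderiv_eq, fderiv_fun_sum fun k _ => (hΓ k).fun_mul (hθv k), hψ]
  simp only [add_mul, Finset.sum_add_distrib, hΓΓ, sum_apply, fderiv_fun_mul (hΓ _) (hθv _),
    add_apply, smul_apply, smul_eq_mul, fderiv_apply_const (hθ a), nabla, mul_add, partialD,
    mul_comm (θ a x _)]
  ring

theorem riemann_eq (hx : x ∈ U) (k m i j : ι) :
    partialD b m (christoffel b G k i j) x - partialD b i (christoffel b G k m j) x
      + ∑ l, (christoffel b G k m l x * christoffel b G l i j x
        - christoffel b G k i l x * christoffel b G l m j x)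
      = b.repr (∑ a, (∑ c, curvForm ψ a c x (b m) (b i) * θ c x (b j)) • X a x) k := by
  let R (k : ι) : ℝ := partialD b m (christoffel b G k i j) x
    - partialD b i (christoffel b G k m j) x
    + ∑ l, (christoffel b G k m l x * christoffel b G l i j x
      - christoffel b G k i l x * christoffel b G l m j x)
  have hR (a : κ) : θ a x (∑ k, R k • b k)
      = ∑ c, curvForm ψ a c x (b m) (b i) * θ c x (b j) := by
    rw [← nablaNabla_sub_nablaNabla (h.contDiffAt_θ hx) (h.differentiableAt_ψ hx),
      h.nablaNabla_eq b hG hx, h.nablaNabla_eq b hG hx, ← Finset.sum_sub_distrib, map_sum]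
    refine Finset.sum_congr rfl fun k _ => ?_
    simp only [R, map_smul, smul_eq_mul, Finset.sum_sub_distrib]
    ring
  calc R k = b.repr (∑ k, R k • b k) k := by rw [b.repr_sum_self]
    _ = b.repr (∑ a, (∑ c, curvForm ψ a c x (b m) (b i) * θ c x (b j)) • X a x) k := by
      rw [← (h.dual x hx).sum_smul (∑ k, R k • b k)]
      simp only [hR]

theorem ricciCoord_eq (hx : x ∈ U) (i j : ι) :
    ricciCoord b G i j x = ∑ a, ∑ c, curvForm ψ a c x (X a x) (b i) * θ c x (b j) := by
  have hΩ (a c : κ) : ∑ k, b.repr (X a x) k * curvForm ψ a c x (b k) (b i)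
      = curvForm ψ a c x (X a x) (b i) :=
    sum_repr_mul_apply b ((curvForm ψ a c x).flip (b i)) (X a x)
  simp only [ricciCoord, h.riemann_eq b hG hx, ← hΩ, Finset.sum_mul, map_sum, map_smul,
    Finsupp.coe_finsetSum, Finset.sum_apply, Finsupp.smul_apply, smul_eq_mul]
  rw [Finset.sum_comm]
  refine Finset.sum_congr rfl fun a _ => ?_
  rw [Finset.sum_comm]
  exact Finset.sum_congr rfl fun c _ => Finset.sum_congr rfl fun k _ => by ring

theorem sum_ricciCoord_eq (hx : x ∈ U) (v w : E) :
    ∑ i, ∑ j, b.repr v i * b.repr w j * ricciCoord b G i j x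
      = ∑ a, ∑ c, curvForm ψ a c x (X a x) v * θ c x w := by
  let B : E →L[ℝ] E →L[ℝ] ℝ := ∑ a, ∑ c, (curvForm ψ a c x (X a x)).smulRight (θ c x)
  have hB (v w : E) : B v w = ∑ a, ∑ c, curvForm ψ a c x (X a x) v * θ c x w := by
    simp [B]
  rw [← hB, ← B.flip_apply, ← sum_repr_mul_apply b (B.flip w) v]
  refine Finset.sum_congr rfl fun i _ => ?_
  rw [B.flip_apply, ← sum_repr_mul_apply b (B (b i)) w, Finset.mul_sum]
  simp only [h.ricciCoord_eq b hG hx, hB, mul_assoc]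

theorem scalarCoord_eq (hx : x ∈ U) :
    scalarCoord b G x = ∑ a, ∑ c, ε c * curvForm ψ a c x (X a x) (X c x) := by
  have htrace (e : κ) : ∑ a, ∑ c, curvForm ψ a c x (X a x) (X e x) * θ c x (X e x)
      = ∑ a, curvForm ψ a e x (X a x) (X e x) := by
    simp [(h.dual x hx).apply_eq]
  calc scalarCoord b G x = ∑ e, ε e * ∑ i, ∑ j,
        b.repr (X e x) i * b.repr (X e x) j * ricciCoord b G i j x := by
        simp only [scalarCoord, h.inv_metric_apply b hG hx, Finset.sum_mul, Finset.mul_sum]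
        rw [Finset.sum_congr rfl fun i _ => Finset.sum_comm, Finset.sum_comm]
        exact Finset.sum_congr rfl fun e _ => Finset.sum_congr rfl fun i _ =>
          Finset.sum_congr rfl fun j _ => by ring
    _ = ∑ e, ∑ a, ε e * curvForm ψ a e x (X a x) (X e x) := by
        simp only [h.sum_ricciCoord_eq b hG hx, htrace, Finset.mul_sum]
    _ = ∑ a, ∑ c, ε c * curvForm ψ a c x (X a x) (X c x) := Finset.sum_comm

end IsLeviCivita

end MovingFrames

/-! ### Slices of a product -/

section Slices

variable {V F : Type*} [NormedAddCommGroup V] [NormedSpace ℝ V] [NormedAddCommGroup F]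
  [NormedSpace ℝ F]

theorem hasFDerivAt_slice {g : ℝ × V → F} {y : ℝ × V} (hg : DifferentiableAt ℝ g y) :
    HasFDerivAt (fun x => g (y.1, x)) ((fderiv ℝ g y).comp (.inr ℝ ℝ V)) y.2 :=
  hg.hasFDerivAt.comp y.2 (hasFDerivAt_prodMk_right y.1 y.2)

theorem deriv_prodMk_left {g : ℝ × V → F} {y : ℝ × V} (hg : DifferentiableAt ℝ g y) :
    deriv (fun t => g (t, y.2)) y.1 = fderiv ℝ g y (1, 0) :=
  (hg.hasFDerivAt.comp_hasDerivAt y.1 (hasFDerivAt_prodMk_left y.1 y.2).hasDerivAt).deriv.trans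
    (by simp)

theorem fderiv_eq_time_add_space {g : ℝ × V → F} {y : ℝ × V} (hg : DifferentiableAt ℝ g y)
    (p : ℝ × V) : fderiv ℝ g y p
      = p.1 • deriv (fun t => g (t, y.2)) y.1 + fderiv ℝ (fun x => g (y.1, x)) y.2 p.2 := by
  rw [deriv_prodMk_left hg, (hasFDerivAt_slice hg).fderiv, ContinuousLinearMap.comp_apply,
    ← map_smul, ← map_add]
  simp

theorem dForm_slice {α : ℝ × V → (ℝ × V) →L[ℝ] ℝ} {y : ℝ × V} (hα : DifferentiableAt ℝ α y)
    (v w : V) : dForm (fun x => (α (y.1, x)).comp (.inr ℝ ℝ V)) y.2 v w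
      = dForm α y (0, v) (0, w) := by
  have hslice := ((hasFDerivAt_slice hα).clm_comp
    (hasFDerivAt_const (ContinuousLinearMap.inr ℝ ℝ V) y.2)).fderiv
  simp [dForm_apply, hslice]

theorem dForm_comp_snd {α : ℝ × V → V →L[ℝ] ℝ} {y : ℝ × V} (hα : DifferentiableAt ℝ α y)
    (p q : ℝ × V) : dForm (fun z => (α z).comp (.snd ℝ ℝ V)) y p q
      = p.1 * deriv (fun t => α (t, y.2)) y.1 q.2 - q.1 * deriv (fun t => α (t, y.2)) y.1 p.2
        + dForm (fun x => α (y.1, x)) y.2 p.2 q.2 := by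
  have hsnd : DifferentiableAt ℝ (fun z => (α z).comp (.snd ℝ ℝ V)) y :=
    hα.clm_comp (differentiableAt_const _)
  have hfderiv (p q : ℝ × V) : fderiv ℝ (fun z => (α z).comp (.snd ℝ ℝ V)) y p q
      = p.1 * deriv (fun t => α (t, y.2)) y.1 q.2
        + fderiv ℝ (fun x => α (y.1, x)) y.2 p.2 q.2 := by
    rw [← fderiv_apply_const hsnd]
    refine (fderiv_apply_const hα p q.2).trans ?_
    rw [fderiv_eq_time_add_space hα, add_apply, smul_apply, smul_eq_mul]
  simp only [dForm_apply, hfderiv]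
  ring

theorem dForm_smul_fst {β : ℝ × V → ℝ} {y : ℝ × V} (hβ : DifferentiableAt ℝ β y) (p q : ℝ × V) :
    dForm (fun z => β z • ContinuousLinearMap.fst ℝ ℝ V) y p q
      = fderiv ℝ (fun x => β (y.1, x)) y.2 p.2 * q.1
        - fderiv ℝ (fun x => β (y.1, x)) y.2 q.2 * p.1 := by
  have hfst := (hβ.hasFDerivAt.smul_const (ContinuousLinearMap.fst ℝ ℝ V)).fderiv
  simp only [dForm_apply, hfst, ContinuousLinearMap.smulRight_apply, smul_apply,
    ContinuousLinearMap.coe_fst', smul_eq_mul, fderiv_eq_time_add_space hβ]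
  ring

end Slices

/-! ### Real Killing spinorial flows in coordinates -/

section FlowInCoordinates

variable {V : Type*} [NormedAddCommGroup V] [NormedSpace ℝ V]

/-- The real Killing spinorial flow equations on an open set of `ℝ × V`, for the lapse `β` and
the coframe `e = (e_u, e_l, e_n)` with dual frame `X`: `τ a` is the one-form `Θ(e_a)`, `s a` the
component `dβ(e_a)`, and `f` a potential. -/
structure FlowInCoordinates (lam : ℝ) (β : ℝ × V → ℝ) (e : Fin 3 → ℝ × V → V →L[ℝ] ℝ)
    (X : Fin 3 → ℝ × V → V) (τ : Fin 3 → ℝ × V → V →L[ℝ] ℝ) (s : Fin 3 → ℝ × V → ℝ)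
    (f : ℝ × V → ℝ) (U : Set (ℝ × V)) : Prop where
  isOpen : IsOpen U
  smooth_β : ContDiffOn ℝ 2 β U
  smooth_e : ∀ a, ContDiffOn ℝ 2 (e a) U
  smooth_τ : ∀ a, ContDiffOn ℝ 1 (τ a) U
  smooth_s : ∀ a, ContDiffOn ℝ 1 (s a) U
  smooth_f : ContDiffOn ℝ 2 f U
  β_ne : ∀ y ∈ U, β y ≠ 0
  dual : ∀ y ∈ U, IsDualFrame (fun a => e a y) (fun a => X a y)
  τ_symm : ∀ y ∈ U, ∀ a c, τ a y (X c y) = τ c y (X a y)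
  dβ : ∀ y ∈ U, fderiv ℝ (fun x => β (y.1, x)) y.2 = ∑ a, s a y • e a y
  evol_eu : ∀ y ∈ U, deriv (fun t => e 0 (t, y.2)) y.1 + s 0 y • e 0 y + β y • τ 0 y
    = ∑ a, s a y • e a y + (lam * β y) • e 1 y
  evol_el : ∀ y ∈ U, deriv (fun t => e 1 (t, y.2)) y.1 + β y • τ 1 y
    = -(s 1 y + lam * β y) • e 0 y
  evol_en : ∀ y ∈ U, deriv (fun t => e 2 (t, y.2)) y.1 + β y • τ 2 y = -s 2 y • e 0 y
  d_eu : ∀ y ∈ U, dForm (fun x => e 0 (y.1, x)) y.2 = wedgeProd (τ 0 y - lam • e 1 y) (e 0 y)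
  d_el : ∀ y ∈ U, dForm (fun x => e 1 (y.1, x)) y.2 = wedgeProd (τ 1 y) (e 0 y)
  d_en : ∀ y ∈ U, dForm (fun x => e 2 (y.1, x)) y.2 + lam • wedgeProd (e 1 y) (e 2 y)
    = wedgeProd (τ 2 y) (e 0 y)
  df_space : ∀ y ∈ U, fderiv ℝ (fun x => f (y.1, x)) y.2 = -τ 0 y - lam • e 1 y
  df_time : ∀ y ∈ U, deriv (fun t => f (t, y.2)) y.1 = s 0 y

section Definitions

variable (lam : ℝ) (β : ℝ × V → ℝ) (e : Fin 3 → ℝ × V → V →L[ℝ] ℝ) (X : Fin 3 → ℝ × V → V)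
  (τ : Fin 3 → ℝ × V → V →L[ℝ] ℝ) (s : Fin 3 → ℝ × V → ℝ)

/-- The spacetime coframe `(β dt, e_u, e_l, e_n)`, with `Sum.inl ()` for the time index. -/
def lapseCoframe : Unit ⊕ Fin 3 → ℝ × V → (ℝ × V) →L[ℝ] ℝ
  | .inl _ => fun y => β y • ContinuousLinearMap.fst ℝ ℝ V
  | .inr a => fun y => (e a y).comp (.snd ℝ ℝ V)

/-- The spacetime frame dual to `lapseCoframe`. -/
def lapseFrame : Unit ⊕ Fin 3 → ℝ × V → ℝ × V
  | .inl _ => fun y => ((β y)⁻¹, 0)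
  | .inr a => fun y => (0, X a y)

/-- The signs of the Lorentzian metric in the spacetime coframe. -/
def lorentzSign : Unit ⊕ Fin 3 → ℝ
  | .inl _ => -1
  | .inr _ => 1

/-- The spacetime one-form `Θ(e_a) - dβ(e_a) dt`, which is minus the connection form between the
time direction and `e_a`. -/
def boostForm (a : Fin 3) (y : ℝ × V) : (ℝ × V) →L[ℝ] ℝ :=
  (τ a y).comp (.snd ℝ ℝ V) - s a y • .fst ℝ ℝ V

/-- The null one-form `β dt + e_u`. -/
def nullForm (y : ℝ × V) : (ℝ × V) →L[ℝ] ℝ :=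
  lapseCoframe β e (.inl ()) y + lapseCoframe β e (.inr 0) y

variable {lam β e τ s} in
theorem lapseCoframe_time_apply (y p : ℝ × V) : lapseCoframe β e (.inl ()) y p = β y * p.1 :=
  rfl

variable {lam β e τ s} in
theorem lapseCoframe_space_apply (a : Fin 3) (y p : ℝ × V) :
    lapseCoframe β e (.inr a) y p = e a y p.2 :=
  rfl

variable {lam β e τ s} in
theorem nullForm_apply (y p : ℝ × V) : nullForm β e y p = β y * p.1 + e 0 y p.2 :=
  rfl

variable {lam β e τ s} in
theorem boostForm_apply (a : Fin 3) (y p : ℝ × V) :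
    boostForm τ s a y p = τ a y p.2 - s a y * p.1 :=
  rfl

/-- The connection forms of the flow between spatial directions. -/
def rotForm : Fin 3 → Fin 3 → ℝ × V → (ℝ × V) →L[ℝ] ℝ :=
  ![![fun _ => 0, fun y => boostForm τ s 1 y - lam • nullForm β e y, boostForm τ s 2],
    ![fun y => lam • nullForm β e y - boostForm τ s 1 y, fun _ => 0,
      fun y => lam • lapseCoframe β e (.inr 2) y],
    ![fun y => -boostForm τ s 2 y, fun y => -lam • lapseCoframe β e (.inr 2) y, fun _ => 0]]

/-- The connection forms of the flow in the spacetime coframe. -/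
def flowConn : Unit ⊕ Fin 3 → Unit ⊕ Fin 3 → ℝ × V → (ℝ × V) →L[ℝ] ℝ
  | .inl _, .inl _ => fun _ => 0
  | .inl _, .inr a => fun y => -boostForm τ s a y
  | .inr a, .inl _ => fun y => -boostForm τ s a y
  | .inr a, .inr c => rotForm lam β e τ s a c

/-- The difference between the curvature forms of the flow and those of a metric of constant
sectional curvature `-λ²`. -/
def flowExcess (a c : Unit ⊕ Fin 3) (y : ℝ × V) : (ℝ × V) →L[ℝ] (ℝ × V) →L[ℝ] ℝ :=
  excessForm (lapseCoframe β e) (flowConn lam β e τ s) (-lam ^ 2) lorentzSign a c y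

/-- The coefficient of the square of the null one-form in the Ricci tensor of the flow. -/
def nullCoeff (y : ℝ × V) : ℝ :=
  ∑ a, flowExcess lam β e τ s (.inr a) (.inl ()) y (lapseFrame β X (.inr a) y)
    (lapseFrame β X (.inr 0) y)

end Definitions

theorem sum_time_add_space {M : Type*} [AddCommMonoid M] (g : Unit ⊕ Fin 3 → M) :
    ∑ a, g a = g (.inl ()) + (g (.inr 0) + g (.inr 1) + g (.inr 2)) := by
  simp [Fin.sum_univ_three]

namespace FlowInCoordinates

variable {lam : ℝ} {β : ℝ × V → ℝ} {e : Fin 3 → ℝ × V → V →L[ℝ] ℝ} {X : Fin 3 → ℝ × V → V}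
  {τ : Fin 3 → ℝ × V → V →L[ℝ] ℝ} {s : Fin 3 → ℝ × V → ℝ} {f : ℝ × V → ℝ} {U : Set (ℝ × V)}
  (h : FlowInCoordinates lam β e X τ s f U)
include h

section Regularity

theorem contDiffOn_lapseCoframe (a : Unit ⊕ Fin 3) : ContDiffOn ℝ 2 (lapseCoframe β e a) U := by
  rcases a with _ | a
  · exact h.smooth_β.smul contDiffOn_const
  · exact (h.smooth_e a).clm_comp contDiffOn_const

theorem contDiffOn_boostForm (a : Fin 3) : ContDiffOn ℝ 1 (boostForm τ s a) U :=
  ((h.smooth_τ a).clm_comp contDiffOn_const).sub ((h.smooth_s a).smul contDiffOn_const)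

theorem contDiffOn_nullForm : ContDiffOn ℝ 2 (nullForm β e) U :=
  (h.contDiffOn_lapseCoframe (.inl ())).add (h.contDiffOn_lapseCoframe (.inr 0))

theorem contDiffOn_rotForm (a c : Fin 3) : ContDiffOn ℝ 1 (rotForm lam β e τ s a c) U := by
  have hν : ContDiffOn ℝ 1 (fun y => lam • nullForm β e y) U :=
    (h.contDiffOn_nullForm.const_smul lam).of_le one_le_two
  have hl := h.contDiffOn_boostForm 1
  have hn := h.contDiffOn_boostForm 2
  have hθ (r : ℝ) : ContDiffOn ℝ 1 (fun y => r • lapseCoframe β e (.inr 2) y) U :=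
    ((h.contDiffOn_lapseCoframe (.inr 2)).const_smul r).of_le one_le_two
  fin_cases a <;> fin_cases c
  exacts [contDiffOn_const, hl.sub hν, hn, hν.sub hl, contDiffOn_const, hθ lam, hn.neg, hθ (-lam),
    contDiffOn_const]

theorem contDiffOn_flowConn (a c : Unit ⊕ Fin 3) :
    ContDiffOn ℝ 1 (flowConn lam β e τ s a c) U := by
  rcases a with _ | a <;> rcases c with _ | c
  exacts [contDiffOn_const, (h.contDiffOn_boostForm c).neg, (h.contDiffOn_boostForm a).neg,
    h.contDiffOn_rotForm a c]

variable {y : ℝ × V} (hy : y ∈ U)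
include hy

theorem differentiableAt_lapseCoframe (a : Unit ⊕ Fin 3) :
    DifferentiableAt ℝ (lapseCoframe β e a) y :=
  ((h.contDiffOn_lapseCoframe a).contDiffAt (h.isOpen.mem_nhds hy)).differentiableAt (by simp)

theorem differentiableAt_nullForm : DifferentiableAt ℝ (nullForm β e) y :=
  (h.contDiffOn_nullForm.contDiffAt (h.isOpen.mem_nhds hy)).differentiableAt (by simp)

theorem differentiableAt_boostForm (a : Fin 3) : DifferentiableAt ℝ (boostForm τ s a) y :=
  ((h.contDiffOn_boostForm a).contDiffAt (h.isOpen.mem_nhds hy)).differentiableAt (by simp)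

end Regularity

section StructureEquations

variable {y : ℝ × V} (hy : y ∈ U)
include hy

theorem sum_wedgeProd_τ : ∑ a, wedgeProd (τ a y) (e a y) = 0 := by
  have hτ (a : Fin 3) (v : V) := (h.dual y hy).covector_eq_sum (τ a y) v
  rw [Fin.sum_univ_three]
  ext v w
  simp only [add_apply, wedgeProd_apply, hτ _ v, hτ _ w, Fin.sum_univ_three, h.τ_symm y hy 1 0,
    h.τ_symm y hy 2 0, h.τ_symm y hy 2 1, zero_apply]
  ring

theorem sum_wedgeProd_τ_apply (v w : V) : τ 0 y v * e 0 y w - τ 0 y w * e 0 y v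
    + (τ 1 y v * e 1 y w - τ 1 y w * e 1 y v) + (τ 2 y v * e 2 y w - τ 2 y w * e 2 y v) = 0 := by
  simpa [Fin.sum_univ_three] using congr($(h.sum_wedgeProd_τ hy) v w)

theorem dForm_time : dForm (lapseCoframe β e (.inl ())) y
    = ∑ a, wedgeProd (boostForm τ s a y) (lapseCoframe β e (.inr a) y) := by
  have hβ := (h.smooth_β.contDiffAt (h.isOpen.mem_nhds hy)).differentiableAt (by simp)
  refine ContinuousLinearMap.ext fun p => ContinuousLinearMap.ext fun q => ?_
  refine (dForm_smul_fst hβ p q).trans ?_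
  simp only [h.dβ y hy, Fin.sum_univ_three, add_apply, smul_apply, smul_eq_mul,
    wedgeProd_apply, boostForm_apply, lapseCoframe_space_apply]
  linear_combination -h.sum_wedgeProd_τ_apply hy p.2 q.2

theorem dForm_space (a : Fin 3) (p q : ℝ × V) : dForm (lapseCoframe β e (.inr a)) y p q
    = p.1 * deriv (fun t => e a (t, y.2)) y.1 q.2 - q.1 * deriv (fun t => e a (t, y.2)) y.1 p.2
      + dForm (fun x => e a (y.1, x)) y.2 p.2 q.2 :=
  dForm_comp_snd (((h.smooth_e a).contDiffAt (h.isOpen.mem_nhds hy)).differentiableAt (by simp)) p q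

theorem dForm_u : dForm (lapseCoframe β e (.inr 0)) y
    = wedgeProd (boostForm τ s 0 y) (lapseCoframe β e (.inl ()) y)
      - wedgeProd (boostForm τ s 1 y - lam • nullForm β e y) (lapseCoframe β e (.inr 1) y)
      - wedgeProd (boostForm τ s 2 y) (lapseCoframe β e (.inr 2) y) := by
  have hevol (v : V) := congr($(h.evol_eu y hy) v)
  have hd (v w : V) := congr($(h.d_eu y hy) v w)
  simp only [Fin.sum_univ_three, add_apply, smul_apply, smul_eq_mul, sub_apply,
    wedgeProd_apply] at hevol hd
  refine ContinuousLinearMap.ext fun p => ContinuousLinearMap.ext fun q => ?_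
  rw [h.dForm_space hy]
  simp only [wedgeProd_apply, boostForm_apply, nullForm_apply, lapseCoframe_time_apply,
    lapseCoframe_space_apply, sub_apply, smul_apply, smul_eq_mul]
  linear_combination p.1 * hevol q.2 - q.1 * hevol p.2 + hd p.2 q.2
    + h.sum_wedgeProd_τ_apply hy p.2 q.2

theorem dForm_l : dForm (lapseCoframe β e (.inr 1)) y
    = wedgeProd (boostForm τ s 1 y) (nullForm β e y)
      - lam • wedgeProd (lapseCoframe β e (.inl ()) y) (lapseCoframe β e (.inr 0) y) := by
  have hevol (v : V) := congr($(h.evol_el y hy) v)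
  have hd (v w : V) := congr($(h.d_el y hy) v w)
  simp only [add_apply, smul_apply, smul_eq_mul, wedgeProd_apply] at hevol hd
  refine ContinuousLinearMap.ext fun p => ContinuousLinearMap.ext fun q => ?_
  rw [h.dForm_space hy]
  simp only [wedgeProd_apply, boostForm_apply, nullForm_apply, lapseCoframe_time_apply,
    lapseCoframe_space_apply, sub_apply, smul_apply, smul_eq_mul]
  linear_combination p.1 * hevol q.2 - q.1 * hevol p.2 + hd p.2 q.2

theorem dForm_n : dForm (lapseCoframe β e (.inr 2)) y
    = wedgeProd (boostForm τ s 2 y) (nullForm β e y)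
      + lam • wedgeProd (lapseCoframe β e (.inr 2) y) (lapseCoframe β e (.inr 1) y) := by
  have hevol (v : V) := congr($(h.evol_en y hy) v)
  have hd (v w : V) := congr($(h.d_en y hy) v w)
  simp only [add_apply, smul_apply, smul_eq_mul, wedgeProd_apply] at hevol hd
  refine ContinuousLinearMap.ext fun p => ContinuousLinearMap.ext fun q => ?_
  rw [h.dForm_space hy]
  simp only [wedgeProd_apply, boostForm_apply, nullForm_apply, lapseCoframe_space_apply,
    add_apply, smul_apply, smul_eq_mul]
  linear_combination p.1 * hevol q.2 - q.1 * hevol p.2 + hd p.2 q.2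

theorem dForm_nullForm : dForm (nullForm β e) y
    = wedgeProd (boostForm τ s 0 y) (nullForm β e y)
      + lam • wedgeProd (nullForm β e y) (lapseCoframe β e (.inr 1) y) := by
  have hadd : dForm (nullForm β e) y
      = dForm (lapseCoframe β e (.inl ())) y + dForm (lapseCoframe β e (.inr 0)) y :=
    dForm_add (h.differentiableAt_lapseCoframe hy _) (h.differentiableAt_lapseCoframe hy _)
  rw [hadd, h.dForm_time hy, h.dForm_u hy, Fin.sum_univ_three]
  refine ContinuousLinearMap.ext fun p => ContinuousLinearMap.ext fun q => ?_
  simp only [wedgeProd_apply, nullForm, sub_apply, add_apply, smul_apply, smul_eq_mul]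
  ring

-- `df = -B_u - λ e_l`, where `B_u` is the boost form.
theorem dForm_boostForm_u :
    dForm (boostForm τ s 0) y = -lam • dForm (lapseCoframe β e (.inr 1)) y := by
  have hf := h.smooth_f.contDiffAt (h.isOpen.mem_nhds hy)
  have hdf : boostForm τ s 0 =ᶠ[𝓝 y]
      fun z => -fderiv ℝ f z + -lam • lapseCoframe β e (.inr 1) z := by
    filter_upwards [h.isOpen.mem_nhds hy] with z hz
    have hfz := (h.smooth_f.contDiffAt (h.isOpen.mem_nhds hz)).differentiableAt (by simp)
    refine ContinuousLinearMap.ext fun p => ?_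
    simp only [boostForm_apply, lapseCoframe_space_apply, add_apply, neg_apply, sub_apply,
      smul_apply, smul_eq_mul, fderiv_eq_time_add_space hfz, h.df_space z hz, h.df_time z hz]
    ring
  have hddf : DifferentiableAt ℝ (fderiv ℝ f) y :=
    (hf.fderiv_right (m := 1) (by norm_num)).differentiableAt (by simp)
  rw [dForm_congr hdf, dForm_add hddf.fun_neg
    ((h.differentiableAt_lapseCoframe hy _).fun_const_smul (-lam)), dForm_neg, dForm_fderiv hf,
    dForm_const_smul]
  refine ContinuousLinearMap.ext fun p => ContinuousLinearMap.ext fun q => ?_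
  simp only [add_apply, neg_apply, zero_apply]
  ring

theorem isDualFrame_lapseFrame :
    IsDualFrame (fun a => lapseCoframe β e a y) (fun a => lapseFrame β X a y) := by
  refine ⟨fun a c => ?_, fun v => ?_⟩
  · rcases a with _ | a <;> rcases c with _ | c <;>
      simp [lapseCoframe, lapseFrame, h.β_ne y hy, (h.dual y hy).apply_eq]
  · ext
    · simp [lapseCoframe, lapseFrame, Prod.fst_sum, mul_comm (β y),
        h.β_ne y hy]
    · simpa [lapseCoframe, lapseFrame, Prod.snd_sum] using (h.dual y hy).sum_smul v.2

theorem dForm_lapseCoframe (a : Unit ⊕ Fin 3) :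
    dForm (lapseCoframe β e a) y
      = -∑ c, wedgeProd (flowConn lam β e τ s a c y) (lapseCoframe β e c y) := by
  refine ContinuousLinearMap.ext fun p => ContinuousLinearMap.ext fun q => ?_
  rw [sum_time_add_space]
  match a with
  | .inl _ =>
    rw [h.dForm_time hy, Fin.sum_univ_three]
    simp only [flowConn, neg_apply, add_apply, zero_apply, wedgeProd_apply]
    ring
  | .inr 0 =>
    rw [h.dForm_u hy]
    simp only [flowConn, rotForm, Matrix.cons_val, neg_apply, add_apply, sub_apply, zero_apply,
      wedgeProd_apply]
    ring
  | .inr 1 =>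
    rw [h.dForm_l hy]
    simp only [flowConn, rotForm, Matrix.cons_val, neg_apply, add_apply, sub_apply, zero_apply,
      smul_apply, smul_eq_mul, wedgeProd_apply, nullForm]
    ring
  | .inr 2 =>
    rw [h.dForm_n hy]
    simp only [flowConn, rotForm, Matrix.cons_val, neg_apply, add_apply, zero_apply,
      smul_apply, smul_eq_mul, wedgeProd_apply, nullForm]
    ring

end StructureEquations

theorem isLeviCivita :
    IsLeviCivita lorentzSign (lapseCoframe β e) (lapseFrame β X) (flowConn lam β e τ s) U where
  isOpen := h.isOpen
  sign a := by rcases a with _ | a <;> simp [lorentzSign]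
  smooth_θ := h.contDiffOn_lapseCoframe
  smooth_ψ := h.contDiffOn_flowConn
  dual _ hy := h.isDualFrame_lapseFrame hy
  torsion _ hy := h.dForm_lapseCoframe hy
  skew y _ a c := by
    rcases a with _ | a <;> rcases c with _ | c
    · simp [flowConn]
    · simp [flowConn, lorentzSign]
    · simp [flowConn, lorentzSign]
    · refine ContinuousLinearMap.ext fun p => ?_
      fin_cases a <;> fin_cases c <;> simp [flowConn, lorentzSign, rotForm]

section Curvature

variable {y : ℝ × V} (hy : y ∈ U)
include hy

theorem flowExcess_skew (a c : Unit ⊕ Fin 3) (p q : ℝ × V) :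
    lorentzSign a * flowExcess lam β e τ s a c y p q
      = -(lorentzSign c * flowExcess lam β e τ s c a y p q) :=
  congr($(h.isLeviCivita.excessForm_skew hy (-lam ^ 2) a c) p q)

theorem flowExcess_space_space (a c : Fin 3) (p q : ℝ × V) :
    flowExcess lam β e τ s (.inr a) (.inr c) y p q
      = -flowExcess lam β e τ s (.inr c) (.inr a) y p q := by
  simpa [lorentzSign] using h.flowExcess_skew hy (.inr a) (.inr c) p q

theorem flowExcess_time_space (a : Fin 3) (p q : ℝ × V) :
    flowExcess lam β e τ s (.inl ()) (.inr a) y p q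
      = flowExcess lam β e τ s (.inr a) (.inl ()) y p q := by
  simpa [lorentzSign] using h.flowExcess_skew hy (.inl ()) (.inr a) p q

theorem flowExcess_self (a : Unit ⊕ Fin 3) (p q : ℝ × V) :
    flowExcess lam β e τ s a a y p q = 0 := by
  have hskew := h.flowExcess_skew hy a a p q
  rcases a with _ | a <;> simp only [lorentzSign] at hskew <;> linarith

theorem flowExcess_u_time (p q : ℝ × V) :
    flowExcess lam β e τ s (.inr 0) (.inl ()) y p q = 0 := by
  have hd : dForm (flowConn lam β e τ s (.inl ()) (.inr 0)) y p q
      = lam * dForm (lapseCoframe β e (.inr 1)) y p q := by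
    refine congr($(dForm_neg (boostForm τ s 0) y) p q).trans ?_
    rw [h.dForm_boostForm_u hy, neg_apply, neg_apply, smul_apply, smul_apply, smul_eq_mul, neg_mul,
      neg_neg]
  rw [← h.flowExcess_time_space hy, flowExcess, excessForm_apply, curvForm_apply, hd,
    h.dForm_l hy, sum_time_add_space]
  simp only [flowConn, rotForm, Matrix.cons_val, neg_apply, sub_apply, zero_apply, smul_apply,
    smul_eq_mul, wedgeProd_apply, nullForm, add_apply, lorentzSign]
  ring

theorem flowExcess_n_l (p q : ℝ × V) : flowExcess lam β e τ s (.inr 2) (.inr 1) y p q = 0 := by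
  have hd : dForm (flowConn lam β e τ s (.inr 2) (.inr 1)) y p q
      = -lam * dForm (lapseCoframe β e (.inr 2)) y p q :=
    congr($(dForm_const_smul (-lam) (lapseCoframe β e (.inr 2)) y) p q)
  rw [flowExcess, excessForm_apply, curvForm_apply, hd, h.dForm_n hy, sum_time_add_space]
  simp only [flowConn, rotForm, Matrix.cons_val, neg_apply, add_apply, sub_apply, zero_apply,
    smul_apply, smul_eq_mul, wedgeProd_apply, nullForm, lorentzSign]
  ring

theorem flowExcess_l_u (p q : ℝ × V) : flowExcess lam β e τ s (.inr 1) (.inr 0) y p q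
    = flowExcess lam β e τ s (.inr 1) (.inl ()) y p q := by
  have hdu : dForm (flowConn lam β e τ s (.inr 1) (.inr 0)) y p q
      = lam * dForm (nullForm β e) y p q - dForm (boostForm τ s 1) y p q := by
    refine congr($(dForm_sub ((h.differentiableAt_nullForm hy).fun_const_smul lam)
      (h.differentiableAt_boostForm hy 1)) p q).trans ?_
    rw [sub_apply, sub_apply, dForm_const_smul]
    rfl
  have hd0 : dForm (flowConn lam β e τ s (.inr 1) (.inl ())) y p q
      = -dForm (boostForm τ s 1) y p q :=
    congr($(dForm_neg (boostForm τ s 1) y) p q)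
  simp only [flowExcess, excessForm_apply, curvForm_apply, hdu, hd0, h.dForm_nullForm hy,
    sum_time_add_space]
  simp only [flowConn, rotForm, Matrix.cons_val, neg_apply, add_apply, sub_apply, zero_apply,
    smul_apply, smul_eq_mul, wedgeProd_apply, nullForm, lorentzSign]
  ring

omit h hy in
theorem flowExcess_n_u (p q : ℝ × V) : flowExcess lam β e τ s (.inr 2) (.inr 0) y p q
    = flowExcess lam β e τ s (.inr 2) (.inl ()) y p q := by
  have hd : dForm (flowConn lam β e τ s (.inr 2) (.inr 0)) y
      = dForm (flowConn lam β e τ s (.inr 2) (.inl ())) y := rfl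
  simp only [flowExcess, excessForm_apply, curvForm_apply, hd, sum_time_add_space]
  simp only [flowConn, rotForm, Matrix.cons_val, neg_apply, add_apply, sub_apply, zero_apply,
    smul_apply, smul_eq_mul, nullForm, lorentzSign]
  ring

theorem flowExcess_space_u (a : Fin 3) (p q : ℝ × V) :
    flowExcess lam β e τ s (.inr a) (.inr 0) y p q
      = flowExcess lam β e τ s (.inr a) (.inl ()) y p q :=
  match a with
  | 0 => by rw [h.flowExcess_self hy, h.flowExcess_u_time hy]
  | 1 => h.flowExcess_l_u hy p q
  | 2 => flowExcess_n_u p q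

theorem flowExcess_l_n (p q : ℝ × V) : flowExcess lam β e τ s (.inr 1) (.inr 2) y p q = 0 := by
  rw [h.flowExcess_space_space hy, h.flowExcess_n_l hy, neg_zero]

theorem flowExcess_bianchi (a : Unit ⊕ Fin 3) (p q r : ℝ × V) :
    ∑ c, (flowExcess lam β e τ s a c y p q * lapseCoframe β e c y r
      + flowExcess lam β e τ s a c y q r * lapseCoframe β e c y p
      + flowExcess lam β e τ s a c y r p * lapseCoframe β e c y q) = 0 :=
  h.isLeviCivita.excessForm_bianchi hy _ _ a p q r

theorem flowExcess_time_null_cyclic (a : Fin 3) (p q r : ℝ × V) :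
    flowExcess lam β e τ s (.inr a) (.inl ()) y p q * nullForm β e y r
      + flowExcess lam β e τ s (.inr a) (.inl ()) y q r * nullForm β e y p
      + flowExcess lam β e τ s (.inr a) (.inl ()) y r p * nullForm β e y q = 0 := by
  have hbianchi := h.flowExcess_bianchi hy (.inr a) p q r
  rw [sum_time_add_space] at hbianchi
  simp only [nullForm, add_apply]
  match a with
  | 0 =>
    simp only [h.flowExcess_u_time hy]
    ring
  | 1 =>
    simp only [h.flowExcess_l_u hy, h.flowExcess_self hy, h.flowExcess_l_n hy] at hbianchi
    linear_combination hbianchi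
  | 2 =>
    simp only [flowExcess_n_u, h.flowExcess_self hy, h.flowExcess_n_l hy] at hbianchi
    linear_combination hbianchi

theorem lapseCoframe_lapseFrame (a c : Unit ⊕ Fin 3) :
    lapseCoframe β e a y (lapseFrame β X c y) = if a = c then 1 else 0 :=
  (h.isLeviCivita.dual y hy).apply_eq a c

theorem flowExcess_time_apply_time_u (a : Fin 3) :
    flowExcess lam β e τ s (.inr a) (.inl ()) y (lapseFrame β X (.inl ()) y)
      (lapseFrame β X (.inr 0) y) = 0 := by
  have hbianchi := h.flowExcess_bianchi hy (.inl ()) (lapseFrame β X (.inl ()) y)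
    (lapseFrame β X (.inr 0) y) (lapseFrame β X (.inr a) y)
  rw [sum_time_add_space] at hbianchi
  simp only [h.flowExcess_self hy, h.flowExcess_time_space hy, h.flowExcess_u_time hy,
    h.lapseCoframe_lapseFrame hy] at hbianchi
  match a with
  | 0 => exact h.flowExcess_u_time hy _ _
  | 1 => simpa using hbianchi
  | 2 => simpa using hbianchi

theorem nullForm_lapseFrame (a : Unit ⊕ Fin 3) : nullForm β e y (lapseFrame β X a y)
    = if a = .inl () ∨ a = .inr 0 then 1 else 0 := by
  simp only [nullForm, add_apply, h.lapseCoframe_lapseFrame hy]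
  rcases a with _ | a
  · simp
  · fin_cases a <;> simp

theorem flowExcess_time_apply (a : Fin 3) (p q : ℝ × V) :
    flowExcess lam β e τ s (.inr a) (.inl ()) y p q
      = nullForm β e y p * flowExcess lam β e τ s (.inr a) (.inl ()) y (lapseFrame β X (.inr 0) y) q
        - nullForm β e y q
          * flowExcess lam β e τ s (.inr a) (.inl ()) y (lapseFrame β X (.inr 0) y) p := by
  have hcyclic := h.flowExcess_time_null_cyclic hy a p q (lapseFrame β X (.inr 0) y)
  have hswap : flowExcess lam β e τ s (.inr a) (.inl ()) y q (lapseFrame β X (.inr 0) y)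
      = -flowExcess lam β e τ s (.inr a) (.inl ()) y (lapseFrame β X (.inr 0) y) q :=
    excessForm_swap ..
  rw [h.nullForm_lapseFrame hy, hswap] at hcyclic
  simp only [or_true, if_true] at hcyclic
  linear_combination hcyclic

theorem flowExcess_time_apply_time (a : Fin 3) (p : ℝ × V) :
    flowExcess lam β e τ s (.inr a) (.inl ()) y (lapseFrame β X (.inl ()) y) p
      = flowExcess lam β e τ s (.inr a) (.inl ()) y (lapseFrame β X (.inr 0) y) p := by
  have hswap : flowExcess lam β e τ s (.inr a) (.inl ()) y (lapseFrame β X (.inr 0) y)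
      (lapseFrame β X (.inl ()) y) = -flowExcess lam β e τ s (.inr a) (.inl ()) y
        (lapseFrame β X (.inl ()) y) (lapseFrame β X (.inr 0) y) :=
    excessForm_swap ..
  rw [h.flowExcess_time_apply hy a (lapseFrame β X (.inl ()) y) p, hswap,
    h.flowExcess_time_apply_time_u hy, h.nullForm_lapseFrame hy]
  simp

theorem flowExcess_time_apply_self {a : Fin 3} (ha : a ≠ 0) (p : ℝ × V) :
    flowExcess lam β e τ s (.inr a) (.inl ()) y (lapseFrame β X (.inr a) y) p
      = flowExcess lam β e τ s (.inr a) (.inl ()) y (lapseFrame β X (.inr a) y)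
        (lapseFrame β X (.inr 0) y) * nullForm β e y p := by
  rw [h.flowExcess_time_apply hy a (lapseFrame β X (.inr a) y) p,
    h.flowExcess_time_apply hy a (lapseFrame β X (.inr a) y) (lapseFrame β X (.inr 0) y),
    h.nullForm_lapseFrame hy, h.nullForm_lapseFrame hy]
  simp [ha]
  ring

theorem nullCoeff_eq : nullCoeff lam β e X τ s y
    = flowExcess lam β e τ s (.inr 1) (.inl ()) y (lapseFrame β X (.inr 1) y)
        (lapseFrame β X (.inr 0) y)
      + flowExcess lam β e τ s (.inr 2) (.inl ()) y (lapseFrame β X (.inr 2) y)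
        (lapseFrame β X (.inr 0) y) := by
  rw [nullCoeff, Fin.sum_univ_three, h.flowExcess_u_time hy, zero_add]

theorem sum_flowExcess_mul (p q : ℝ × V) :
    ∑ a, ∑ c, flowExcess lam β e τ s a c y (lapseFrame β X a y) p * lapseCoframe β e c y q
      = nullCoeff lam β e X τ s y * (nullForm β e y p * nullForm β e y q) := by
  have hul := h.flowExcess_space_space hy 0 1
  have hun := h.flowExcess_space_space hy 0 2
  simp only [h.flowExcess_space_u hy] at hul hun
  simp only [sum_time_add_space, h.flowExcess_self hy, h.flowExcess_time_space hy,
    h.flowExcess_u_time hy, hul, hun, h.flowExcess_space_u hy, h.flowExcess_l_n hy,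
    h.flowExcess_n_l hy, h.flowExcess_time_apply_time hy,
    h.flowExcess_time_apply_self hy one_ne_zero p,
    h.flowExcess_time_apply_self hy (a := 2) (by decide) p, h.nullCoeff_eq hy]
  rw [nullForm, add_apply, add_apply]
  ring

theorem sum_curvForm_mul (p q : ℝ × V) :
    ∑ a, ∑ c, curvForm (flowConn lam β e τ s) a c y (lapseFrame β X a y) p
        * lapseCoframe β e c y q
      = -3 * lam ^ 2 * ∑ a, lorentzSign a * (lapseCoframe β e a y p * lapseCoframe β e a y q)
        + nullCoeff lam β e X τ s y * (nullForm β e y p * nullForm β e y q) := by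
  rw [h.isLeviCivita.sum_curvForm_mul_eq hy (-lam ^ 2), ← h.sum_flowExcess_mul hy]
  simp only [flowExcess, Fintype.card_sum, Fintype.card_unique, Fintype.card_fin]
  push_cast
  ring

theorem sum_flowExcess_apply :
    ∑ a, ∑ c, flowExcess lam β e τ s (.inr a) (.inr c) y (lapseFrame β X (.inr a) y)
      (lapseFrame β X (.inr c) y) = 2 * nullCoeff lam β e X τ s y := by
  have hu (a : Fin 3) : flowExcess lam β e τ s (.inr 0) (.inr a) y (lapseFrame β X (.inr 0) y)
      (lapseFrame β X (.inr a) y) = flowExcess lam β e τ s (.inr a) (.inl ()) y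
        (lapseFrame β X (.inr a) y) (lapseFrame β X (.inr 0) y) := by
    rw [h.flowExcess_space_space hy, h.flowExcess_space_u hy]
    exact neg_eq_iff_eq_neg.2 (excessForm_swap ..)
  simp only [Fin.sum_univ_three, hu, h.flowExcess_u_time hy, h.flowExcess_self hy,
    h.flowExcess_space_u hy, h.flowExcess_l_n hy, h.flowExcess_n_l hy, h.nullCoeff_eq hy]
  ring

end Curvature

section Slice

theorem isLeviCivita_slice (t : ℝ) :
    IsLeviCivita (fun _ => 1) (fun a x => e a (t, x)) (fun a x => X a (t, x))
      (fun a c x => (rotForm lam β e τ s a c (t, x)).comp (.inr ℝ ℝ V)) {x | (t, x) ∈ U} where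
  isOpen := h.isOpen.preimage (Continuous.prodMk_right t)
  sign _ := one_mul 1
  smooth_θ a := (h.smooth_e a).comp (contDiff_prodMk_right t).contDiffOn fun _ => id
  smooth_ψ a c := ((h.contDiffOn_rotForm a c).comp (contDiff_prodMk_right t).contDiffOn
    fun _ => id).clm_comp contDiffOn_const
  dual x hx := h.dual (t, x) hx
  torsion x hx a := by
    ext v w
    have hslice := dForm_slice (h.differentiableAt_lapseCoframe hx (.inr a)) v w
    refine hslice.trans ((h.isLeviCivita.dForm_eq hx (.inr a) (0, v) (0, w)).trans ?_)
    simp [flowConn, lapseCoframe]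
  skew x hx a c := by
    ext v
    simpa [flowConn, lorentzSign] using congr($(h.isLeviCivita.skew _ hx (.inr a) (.inr c)) (0, v))

theorem curvForm_slice {t : ℝ} {x : V} (hx : (t, x) ∈ U) (a c : Fin 3) (v w : V) :
    curvForm (fun a c x => (rotForm lam β e τ s a c (t, x)).comp (.inr ℝ ℝ V)) a c x v w
      = curvForm (flowConn lam β e τ s) (.inr a) (.inr c) (t, x) (0, v) (0, w)
        - (τ a (t, x) v * τ c (t, x) w - τ a (t, x) w * τ c (t, x) v) := by
  have hslice := dForm_slice (h.isLeviCivita.differentiableAt_ψ hx (.inr a) (.inr c)) v w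
  simp only [flowConn] at hslice
  rw [curvForm_apply, curvForm_apply, hslice, Fintype.sum_sum_type]
  simp only [flowConn, Finset.univ_unique, Finset.sum_singleton, neg_apply, boostForm_apply,
    ContinuousLinearMap.comp_apply, ContinuousLinearMap.inr_apply]
  ring

theorem two_mul_nullCoeff {t : ℝ} {x : V} (hx : (t, x) ∈ U) {ι : Type*} [Fintype ι]
    [DecidableEq ι] (b : Module.Basis ι ℝ V) {G : V → Matrix ι ι ℝ}
    (hG : ∀ z, (t, z) ∈ U → ∀ i j, G z i j = ∑ a, e a (t, z) (b i) * e a (t, z) (b j)) :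
    2 * nullCoeff lam β e X τ s (t, x)
      = scalarCoord b G x - ∑ a, ∑ c, τ a (t, x) (X c (t, x)) * τ c (t, x) (X a (t, x))
        + (∑ a, τ a (t, x) (X a (t, x))) ^ 2 + 6 * lam ^ 2 := by
  have hcurv (a c : Fin 3) : curvForm (flowConn lam β e τ s) (.inr a) (.inr c) (t, x)
      (0, X a (t, x)) (0, X c (t, x))
      = flowExcess lam β e τ s (.inr a) (.inr c) (t, x) (lapseFrame β X (.inr a) (t, x))
        (lapseFrame β X (.inr c) (t, x)) - lam ^ 2 * (1 - if a = c then 1 else 0) := by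
    rw [flowExcess, excessForm_apply]
    simp only [h.lapseCoframe_lapseFrame hx, lorentzSign, Sum.inr.injEq, eq_comm (a := c)]
    split_ifs <;> simp [lapseFrame]
  rw [(h.isLeviCivita_slice t).scalarCoord_eq b (by simpa using hG) hx]
  simp only [h.curvForm_slice hx, hcurv, one_mul, Finset.sum_sub_distrib, ← Finset.mul_sum,
    h.sum_flowExcess_apply hx, ← Finset.sum_mul]
  simp only [Finset.sum_const, Finset.card_univ, Fintype.card_fin, nsmul_eq_mul,
    Finset.sum_ite_eq, Finset.mem_univ, if_true]
  push_cast
  ring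

end Slice

end FlowInCoordinates

end FlowInCoordinates

/-! ### One-forms in charts -/

section Charts

variable {E : Type*} [NormedAddCommGroup E] [NormedSpace ℝ E]

theorem dForm_pullback {E' : Type*} [NormedAddCommGroup E'] [NormedSpace ℝ E']
    {α : E' → E' →L[ℝ] ℝ} {φ : E → E'} {x : E} (hφ : ContDiffAt ℝ 2 φ x)
    (hα : DifferentiableAt ℝ α (φ x)) (v w : E) :
    dForm (fun z => (α (φ z)).comp (fderiv ℝ φ z)) x v w
      = dForm α (φ x) (fderiv ℝ φ x v) (fderiv ℝ φ x w) := by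
  have hαφ : HasFDerivAt (fun z => α (φ z)) ((fderiv ℝ α (φ x)).comp (fderiv ℝ φ x)) x :=
    hα.hasFDerivAt.comp x (hφ.differentiableAt (by norm_num)).hasFDerivAt
  have hφ' : HasFDerivAt (fderiv ℝ φ) (fderiv ℝ (fderiv ℝ φ) x) x :=
    ((hφ.fderiv_right (m := 1) (by norm_num)).differentiableAt (by norm_num)).hasFDerivAt
  have hpull (v w : E) : fderiv ℝ (fun z => (α (φ z)).comp (fderiv ℝ φ z)) x v w
      = fderiv ℝ α (φ x) (fderiv ℝ φ x v) (fderiv ℝ φ x w)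
        + α (φ x) (fderiv ℝ (fderiv ℝ φ) x v w) := by
    simp [(hαφ.clm_comp hφ').fderiv, add_comm]
  rw [dForm_apply, dForm_apply, hpull, hpull, (hφ.isSymmSndFDerivAt (by simp)) v w]
  ring

variable {H : Type*} [TopologicalSpace H] {I : ModelWithCorners ℝ E H} {M : Type*}
  [TopologicalSpace M] [ChartedSpace H M]

variable (I) in
/-- The pullback of a one-form by the inverse of the preferred chart at `p`. -/
def chartForm (p : M) (α : ∀ q : M, TangentSpace I q →L[ℝ] ℝ) (x : E) : E →L[ℝ] ℝ :=
  (α ((extChartAt I p).symm x)).comp (chartSymmDeriv I p x)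

variable [I.Boundaryless] {p q : M} {x : E}

section FirstOrder

variable [IsManifold I 1 M] (hx : x ∈ (extChartAt I p).target)
include hx

theorem mdifferentiableAt_extChartAt_symm :
    MDifferentiableAt 𝓘(ℝ, E) I (extChartAt I p).symm x :=
  (mdifferentiableOn_extChartAt_symm x hx).mdifferentiableAt
    ((isOpen_extChartAt_target p).mem_nhds hx)

theorem isInvertible_chartSymmDeriv : (chartSymmDeriv I p x).IsInvertible := by
  have hinv := isInvertible_mfderivWithin_extChartAt_symm hx
  rwa [ModelWithCorners.Boundaryless.range_eq_univ, mfderivWithin_univ] at hinv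

theorem hasFDerivAt_comp_extChartAt_symm {φ : M → ℝ}
    (hφ : MDifferentiableAt I 𝓘(ℝ, ℝ) φ ((extChartAt I p).symm x)) :
    HasFDerivAt (fun z => φ ((extChartAt I p).symm z)) (chartForm I p (mvfderiv I φ) x) x :=
  (hφ.hasMFDerivAt.comp x (mdifferentiableAt_extChartAt_symm hx).hasMFDerivAt).hasFDerivAt

theorem exists_continuousLinearEquiv_chartForm : ∃ L : (E →L[ℝ] ℝ) ≃L[ℝ] (E →L[ℝ] ℝ),
    ∀ α : ∀ q : M, TangentSpace I q →L[ℝ] ℝ,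
      chartForm I p α x = L (α ((extChartAt I p).symm x)) := by
  obtain ⟨L, hL⟩ := isInvertible_chartSymmDeriv (I := I) hx
  refine ⟨ContinuousLinearEquiv.arrowCongr (G := ℝ) (H := ℝ) (E := E) (F := E) L.symm (.refl ℝ ℝ),
    fun α => ?_⟩
  rw [chartForm, ← hL]
  rfl

omit hx in
theorem eq_of_chartForm_eq {α β : ∀ q : M, TangentSpace I q →L[ℝ] ℝ}
    (h : chartForm I p α (extChartAt I p p) = chartForm I p β (extChartAt I p p)) :
    α p = β p := by
  obtain ⟨L, hL⟩ := exists_continuousLinearEquiv_chartForm (mem_extChartAt_target (I := I) p)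
  rw [hL, hL] at h
  have heq := L.injective h
  rwa [extChartAt_to_inv] at heq

theorem deriv_chartForm (α : ℝ → ∀ q : M, TangentSpace I q →L[ℝ] ℝ) (t : ℝ) :
    deriv (fun s => chartForm I p (α s) x) t
      = chartForm I p (fun q => deriv (fun s => α s q) t) x := by
  obtain ⟨L, hL⟩ := exists_continuousLinearEquiv_chartForm (I := I) hx
  simp only [hL, ← fderiv_apply_one_eq_deriv]
  exact congr($(L.comp_fderiv (f := fun s => α s ((extChartAt I p).symm x)) (x := t)) 1)

theorem differentiableAt_chartForm_iff {α : ℝ → ∀ q : M, TangentSpace I q →L[ℝ] ℝ} {t : ℝ} :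
    DifferentiableAt ℝ (fun s => chartForm I p (α s) x) t
      ↔ DifferentiableAt ℝ (F := E →L[ℝ] ℝ) (fun s => α s ((extChartAt I p).symm x)) t := by
  obtain ⟨L, hL⟩ := exists_continuousLinearEquiv_chartForm (I := I) hx
  simp only [hL]
  exact L.comp_differentiableAt_iff

theorem fderiv_chartTransition (hq : (extChartAt I p).symm x ∈ (extChartAt I q).source) :
    fderiv ℝ (fun z => extChartAt I q ((extChartAt I p).symm z)) x
      = (mfderiv I 𝓘(ℝ, E) (extChartAt I q) ((extChartAt I p).symm x)).comp
        (chartSymmDeriv I p x) := by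
  rw [← mfderiv_eq_fderiv]
  exact mfderiv_comp x (mdifferentiableAt_extChartAt (by simpa [extChartAt_source] using hq))
    (mdifferentiableAt_extChartAt_symm hx)

omit hx in
theorem chartSymmDeriv_mfderiv_extChartAt {p' : M} (hp' : p' ∈ (extChartAt I p).source)
    (v : TangentSpace I p') :
    (chartSymmDeriv I p (extChartAt I p p') (mfderiv I 𝓘(ℝ, E) (extChartAt I p) p' v) : E) = v := by
  have hleftInv := congr($(mfderivWithin_extChartAt_symm_comp_mfderiv_extChartAt' hp') v)
  rwa [ModelWithCorners.Boundaryless.range_eq_univ, mfderivWithin_univ] at hleftInv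

theorem chartForm_eq_comp_chartTransition
    (hq : (extChartAt I p).symm x ∈ (extChartAt I q).source)
    (α : ∀ q : M, TangentSpace I q →L[ℝ] ℝ) :
    chartForm I p α x = (chartForm I q α (extChartAt I q ((extChartAt I p).symm x))).comp
      (fderiv ℝ (fun z => extChartAt I q ((extChartAt I p).symm z)) x) := by
  have hpoint := (extChartAt I q).left_inv hq
  ext v
  have hvec : (chartSymmDeriv I q (extChartAt I q ((extChartAt I p).symm x))
      (fderiv ℝ (fun z => extChartAt I q ((extChartAt I p).symm z)) x v) : E)
      = chartSymmDeriv I p x v := by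
    rw [fderiv_chartTransition hx hq]
    exact chartSymmDeriv_mfderiv_extChartAt hq (chartSymmDeriv I p x v)
  let α' (q : M) (w : E) : ℝ := α q w
  exact (congrArg₂ α' hpoint hvec).symm

end FirstOrder

theorem contDiffAt_chartTransition {n : ℕ∞ω} [IsManifold I n M] (hx : x ∈ (extChartAt I p).target)
    (hq : (extChartAt I p).symm x ∈ (extChartAt I q).source) :
    ContDiffAt ℝ n (fun z => extChartAt I q ((extChartAt I p).symm z)) x :=
  contMDiffAt_iff_contDiffAt.1 (ContMDiffAt.comp x
    (contMDiffAt_extChartAt' (by simpa [extChartAt_source] using hq))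
    ((contMDiffOn_extChartAt_symm p).contMDiffAt ((isOpen_extChartAt_target p).mem_nhds hx)))

theorem extD_chartSymmDeriv [IsManifold I 2 M] (hx : x ∈ (extChartAt I p).target)
    {α : ∀ q : M, TangentSpace I q →L[ℝ] ℝ}
    (hα : DifferentiableAt ℝ (chartForm I ((extChartAt I p).symm x) α)
      (extChartAt I ((extChartAt I p).symm x) ((extChartAt I p).symm x))) (v w : E) :
    extD I α ((extChartAt I p).symm x) (chartSymmDeriv I p x v) (chartSymmDeriv I p x w)
      = dForm (chartForm I p α) x v w := by
  have : IsManifold I 1 M := .of_le one_le_two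
  set q := (extChartAt I p).symm x
  have hqs := mem_extChartAt_source (I := I) q
  have hchange : chartForm I p α =ᶠ[𝓝 x] fun z =>
      (chartForm I q α (extChartAt I q ((extChartAt I p).symm z))).comp
        (fderiv ℝ (fun z => extChartAt I q ((extChartAt I p).symm z)) z) := by
    filter_upwards [(mdifferentiableAt_extChartAt_symm hx).continuousAt
        ((isOpen_extChartAt_source q).mem_nhds hqs),
      (isOpen_extChartAt_target p).mem_nhds hx] with z hz hz'
      using chartForm_eq_comp_chartTransition hz' hz α
  rw [dForm_congr hchange, dForm_pullback (contDiffAt_chartTransition hx hqs) hα,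
    fderiv_chartTransition hx hqs, dForm_apply]
  exact congrArg₂ (· - ·) (fderiv_apply_const hα _ _) (fderiv_apply_const hα _ _)

end Charts

section FamiliesInCharts

variable {S : Type*} [TopologicalSpace S] [ChartedSpace (EuclideanSpace ℝ (Fin 3)) S]

/-- A family of functions on `S`, read in the preferred chart at `p`. -/
def functionInChart (p : S) (f : ℝ → S → ℝ) (y : ℝ × EuclideanSpace ℝ (Fin 3)) : ℝ :=
  f y.1 ((extChartAt (𝓡 3) p).symm y.2)

/-- A family of one-forms on `S`, read in the preferred chart at `p`. -/
def formInChart (p : S) (α : ℝ → ∀ q : S, TangentSpace (𝓡 3) q →L[ℝ] ℝ)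
    (y : ℝ × EuclideanSpace ℝ (Fin 3)) : EuclideanSpace ℝ (Fin 3) →L[ℝ] ℝ :=
  chartForm (𝓡 3) p (α y.1) y.2

theorem formInChart_apply (p : S) (α : ℝ → ∀ q : S, TangentSpace (𝓡 3) q →L[ℝ] ℝ)
    (y : ℝ × EuclideanSpace ℝ (Fin 3)) (v : EuclideanSpace ℝ (Fin 3)) :
    formInChart p α y v
      = α y.1 ((extChartAt (𝓡 3) p).symm y.2) (chartSymmDeriv (𝓡 3) p y.2 v) :=
  rfl

variable {J : Set ℝ} {f : ℝ → S → ℝ}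

theorem SmoothFunctions.contMDiff (hf : SmoothFunctions J f) {t : ℝ} (ht : t ∈ J) :
    ContMDiff (𝓡 3) 𝓘(ℝ, ℝ) ∞ (f t) :=
  ContMDiffOn.comp_contMDiff (g := fun q : ℝ × S => f q.1 q.2) hf
    (contMDiff_const.prodMk contMDiff_id) fun _ => ⟨ht, mem_univ _⟩

variable [IsManifold (𝓡 3) ∞ S] {α : ℝ → ∀ q : S, TangentSpace (𝓡 3) q →L[ℝ] ℝ}

section Smoothness

variable (p : S)

theorem contMDiffOn_prodMk_extChartAt_symm (J : Set ℝ) :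
    ContMDiffOn 𝓘(ℝ, ℝ × EuclideanSpace ℝ (Fin 3)) (𝓘(ℝ, ℝ).prod (𝓡 3)) ∞
      (fun y : ℝ × EuclideanSpace ℝ (Fin 3) => (y.1, (extChartAt (𝓡 3) p).symm y.2))
      (J ×ˢ (extChartAt (𝓡 3) p).target) :=
  contDiff_fst.contMDiff.contMDiffOn.prodMk
    ((contMDiffOn_extChartAt_symm p).comp contDiff_snd.contMDiff.contMDiffOn fun _ hy => hy.2)

theorem SmoothFunctions.contDiffOn_functionInChart (hf : SmoothFunctions J f) :
    ContDiffOn ℝ ∞ (functionInChart p f) (J ×ˢ (extChartAt (𝓡 3) p).target) :=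
  contMDiffOn_iff_contDiffOn.1 <| ContMDiffOn.comp hf (contMDiffOn_prodMk_extChartAt_symm p J)
    fun _ hy => ⟨hy.1, mem_univ _⟩

theorem contMDiffOn_chartSymmDeriv (v : EuclideanSpace ℝ (Fin 3)) :
    ContMDiffOn (𝓡 3) ((𝓡 3).prod (𝓡 3)) ∞
      (fun x => TotalSpace.mk' (EuclideanSpace ℝ (Fin 3))
        (E := fun q : S => TangentSpace (𝓡 3) q) ((extChartAt (𝓡 3) p).symm x)
        (chartSymmDeriv (𝓡 3) p x v))
      (extChartAt (𝓡 3) p).target := by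
  have hconst : ContMDiff (𝓡 3) ((𝓡 3).prod (𝓡 3)) ∞ (fun x : EuclideanSpace ℝ (Fin 3) =>
      (⟨x, v⟩ : TangentBundle (𝓡 3) (EuclideanSpace ℝ (Fin 3)))) :=
    contMDiff_vectorSpace_iff_contDiff.2 contDiff_const
  have hopen := isOpen_extChartAt_target (I := 𝓡 3) p
  have htangent := (contMDiffOn_extChartAt_symm (I := 𝓡 3) (n := ∞) p).contMDiffOn_tangentMapWithin
    (m := ∞) le_rfl hopen.uniqueMDiffOn
  refine (htangent.comp hconst.contMDiffOn fun _ hx => hx).congr fun x hx => ?_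
  simp only [tangentMapWithin, Function.comp_def, chartSymmDeriv, mfderivWithin_of_isOpen hopen hx]
  rfl

theorem SmoothOneForms.contDiffOn_formInChart (hα : SmoothOneForms J α) :
    ContDiffOn ℝ ∞ (formInChart p α) (J ×ˢ (extChartAt (𝓡 3) p).target) := by
  refine contDiffOn_clm_apply.2 fun v y hy => ?_
  have hform := ContMDiffOn.comp hα (contMDiffOn_prodMk_extChartAt_symm p J)
    fun y hy => ⟨hy.1, mem_univ _⟩
  have hframe := (contMDiffOn_chartSymmDeriv p v).comp
    (contDiff_snd (𝕜 := ℝ) (E := ℝ)).contMDiff.contMDiffOn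
    fun (y : ℝ × EuclideanSpace ℝ (Fin 3)) (hy : y ∈ J ×ˢ (extChartAt (𝓡 3) p).target) => hy.2
  have happly := ContMDiffOn.clm_bundle_apply (F₁ := EuclideanSpace ℝ (Fin 3)) (F₂ := ℝ)
    (E₁ := fun q : S => TangentSpace (𝓡 3) q) (E₂ := Bundle.Trivial S ℝ) (IB := 𝓡 3)
    (b := fun y : ℝ × EuclideanSpace ℝ (Fin 3) => (extChartAt (𝓡 3) p).symm y.2) hform hframe
  exact (contMDiffWithinAt_totalSpace.1 (happly y hy)).2.contDiffWithinAt

end Smoothness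

variable {p : S} {y : ℝ × EuclideanSpace ℝ (Fin 3)}

theorem deriv_formInChart (hy : y.2 ∈ (extChartAt (𝓡 3) p).target) :
    deriv (fun t => formInChart p α (t, y.2)) y.1
      = formInChart p (fun t q => deriv (fun s => α s q) t) y :=
  deriv_chartForm hy α y.1

theorem SmoothOneForms.differentiableAt (hα : SmoothOneForms J α) {t : ℝ} (ht : J ∈ 𝓝 t) (q : S) :
    DifferentiableAt ℝ (F := EuclideanSpace ℝ (Fin 3) →L[ℝ] ℝ) (fun s => α s q) t := by
  have hq := mem_extChartAt_target (I := 𝓡 3) q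
  have hslice : ContDiffOn ℝ ∞ (fun s => chartForm (𝓡 3) q (α s) (extChartAt (𝓡 3) q q)) J :=
    (hα.contDiffOn_formInChart q).comp (contDiffOn_id.prodMk contDiffOn_const)
      fun _ hs => ⟨hs, hq⟩
  have hdiff := (differentiableAt_chartForm_iff hq).1
    ((hslice.contDiffAt ht).differentiableAt (by simp))
  rwa [extChartAt_to_inv] at hdiff

variable (hy : y ∈ J ×ˢ (extChartAt (𝓡 3) p).target)
include hy

theorem SmoothFunctions.fderiv_functionInChart (hf : SmoothFunctions J f) :
    fderiv ℝ (fun x => functionInChart p f (y.1, x)) y.2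
      = formInChart p (fun t => mvfderiv (𝓡 3) (f t)) y :=
  (hasFDerivAt_comp_extChartAt_symm hy.2
    ((hf.contMDiff hy.1).mdifferentiable (by simp) _)).fderiv

theorem SmoothOneForms.extD_chartSymmDeriv (hα : SmoothOneForms J α)
    (v w : EuclideanSpace ℝ (Fin 3)) :
    extD (𝓡 3) (α y.1) ((extChartAt (𝓡 3) p).symm y.2) (chartSymmDeriv (𝓡 3) p y.2 v)
        (chartSymmDeriv (𝓡 3) p y.2 w)
      = dForm (fun x => formInChart p α (y.1, x)) y.2 v w := by
  refine KillingFlow.extD_chartSymmDeriv hy.2 ?_ v w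
  set q := (extChartAt (𝓡 3) p).symm y.2
  have hslice : ContDiffOn ℝ ∞ (chartForm (𝓡 3) q (α y.1)) (extChartAt (𝓡 3) q).target :=
    (hα.contDiffOn_formInChart q).comp (contDiffOn_const.prodMk contDiffOn_id)
      fun _ hx => ⟨hy.1, hx⟩
  exact (hslice.contDiffAt (extChartAt_target_mem_nhds q)).differentiableAt (by simp)

end FamiliesInCharts

/-! ### The adapted frame of a family -/

section FamilyFrames

variable {S : Type*} [TopologicalSpace S] [ChartedSpace (EuclideanSpace ℝ (Fin 3)) S]

namespace Family

variable (F : Family S)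

/-- The coframe `(e_u, e_l, e_n)`, indexed by `0, 1, 2`. -/
def coframe : Fin 3 → ℝ → S → EuclideanSpace ℝ (Fin 3) →L[ℝ] ℝ
  | 0 => F.eu
  | 1 => F.el
  | 2 => F.en

/-- The frame metrically dual to the coframe. -/
def frame (a : Fin 3) (t : ℝ) (p : S) : EuclideanSpace ℝ (Fin 3) :=
  sharp (F.h t p) (F.coframe a t p)

theorem h_eq_coframeMetric (t : ℝ) (p : S) : F.h t p = coframeMetric fun a => F.coframe a t p := by
  rw [coframeMetric, Fin.sum_univ_three]
  rfl

/-- The coframe of the family, read in the preferred chart at `p`. -/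
def coframeInChart (p : S) (a : Fin 3) :
    ℝ × EuclideanSpace ℝ (Fin 3) → EuclideanSpace ℝ (Fin 3) →L[ℝ] ℝ :=
  formInChart p (F.coframe a)

/-- The frame of the family, read in the preferred chart at `p`. -/
def frameInChart (p : S) (a : Fin 3) (y : ℝ × EuclideanSpace ℝ (Fin 3)) :
    EuclideanSpace ℝ (Fin 3) :=
  (chartSymmDeriv (𝓡 3) p y.2).inverse (F.frame a y.1 ((extChartAt (𝓡 3) p).symm y.2))

/-- The one-forms `Θ(e_u)`, `Θ(e_l)`, `Θ(e_n)`, read in the preferred chart at `p`. -/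
def ΘInChart (p : S) (a : Fin 3) :
    ℝ × EuclideanSpace ℝ (Fin 3) → EuclideanSpace ℝ (Fin 3) →L[ℝ] ℝ :=
  formInChart p fun t q => F.ΘOf t q (F.coframe a t q)

/-- The functions `dβ(e_u)`, `dβ(e_l)`, `dβ(e_n)`, read in the preferred chart at `p`. -/
def dβInChart (p : S) (a : Fin 3) : ℝ × EuclideanSpace ℝ (Fin 3) → ℝ :=
  functionInChart p fun t q => F.dβOf t q (F.coframe a t q)

end Family

variable [IsManifold (𝓡 3) ∞ S] {lam : ℝ} {J : Set ℝ} {F : Family S}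

namespace IsKillingSpinorialFlow

variable (hF : IsKillingSpinorialFlow lam J F)
include hF

theorem smoothOneForms_coframe (a : Fin 3) : SmoothOneForms J (F.coframe a) :=
  match a with
  | 0 => hF.smooth_eu
  | 1 => hF.smooth_el
  | 2 => hF.smooth_en

section Pointwise

variable {t : ℝ} (ht : t ∈ J) (q : S)
include ht

theorem isDualFrame : IsDualFrame (fun a => F.coframe a t q) (fun a => F.frame a t q) := by
  have hcoframe : (fun a => F.coframe a t q) = ![F.eu t q, F.el t q, F.en t q] :=
    funext fun | 0 => rfl | 1 => rfl | 2 => rfl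
  obtain ⟨X, hX⟩ := exists_isDualFrame_of_linearIndependent (e := fun a => F.coframe a t q)
    (hcoframe ▸ hF.coframe t ht q) (by simp)
  have hframe (a : Fin 3) : F.frame a t q = X a := by
    rw [Family.frame, F.h_eq_coframeMetric]
    exact hX.inverse_coframeMetric_coframe a
  simpa only [hframe] using hX

theorem traceWrt_eq_sum : traceWrt (F.h t q) (F.Θ t q)
    = ∑ a, F.ΘOf t q (F.coframe a t q) (F.frame a t q) := by
  rw [traceWrt, F.h_eq_coframeMetric]
  exact ((hF.isDualFrame ht q).trace_inverse_comp (F.Θ t q)).trans rfl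

theorem normSqWrt_eq_sum : normSqWrt (F.h t q) (F.Θ t q)
    = ∑ a, ∑ c, F.ΘOf t q (F.coframe a t q) (F.frame c t q)
      * F.ΘOf t q (F.coframe c t q) (F.frame a t q) := by
  rw [normSqWrt, F.h_eq_coframeMetric]
  exact ((hF.isDualFrame ht q).trace_inverse_comp_sq (F.Θ t q)).trans rfl

theorem Θ_apply (hJ : IsOpen J) (v w : EuclideanSpace ℝ (Fin 3)) :
    F.Θ t q v w = -(1 / (2 * F.β t q)) * ∑ a, (F.coframe a t q v
      * deriv (fun s => F.coframe a s q) t w + deriv (fun s => F.coframe a s q) t v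
        * F.coframe a t q w) := by
  rw [← deriv_coframeMetric_apply fun a =>
    ((hF.smoothOneForms_coframe a).differentiableAt (hJ.mem_nhds ht) q).hasDerivAt]
  simp only [← F.h_eq_coframeMetric]
  rfl

theorem Θ_comm (hJ : IsOpen J) (v w : EuclideanSpace ℝ (Fin 3)) : F.Θ t q v w = F.Θ t q w v := by
  simp only [hF.Θ_apply ht q hJ, mul_comm, add_comm]

theorem ΘOf_coframe (hJ : IsOpen J) (a : Fin 3) (w : EuclideanSpace ℝ (Fin 3)) :
    F.ΘOf t q (F.coframe a t q) w
      = -(1 / (2 * F.β t q)) * (deriv (fun s => F.coframe a s q) t w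
        + ∑ c, deriv (fun s => F.coframe c s q) t (F.frame a t q) * F.coframe c t q w) := by
  refine (hF.Θ_apply ht q hJ (F.frame a t q) w).trans ?_
  simp [(hF.isDualFrame ht q).apply_eq, Finset.sum_add_distrib]

end Pointwise

section InChart

variable (p : S) (hJ : IsOpen J)

theorem contDiffOn_coframeInChart (a : Fin 3) : ContDiffOn ℝ ∞ (F.coframeInChart p a)
    (J ×ˢ (extChartAt (𝓡 3) p).target) :=
  (hF.smoothOneForms_coframe a).contDiffOn_formInChart p

section Pointwise

variable {p} {y : ℝ × EuclideanSpace ℝ (Fin 3)} (hy : y ∈ J ×ˢ (extChartAt (𝓡 3) p).target)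
include hy

omit hF in
theorem deriv_coframeInChart (a : Fin 3) (v : EuclideanSpace ℝ (Fin 3)) :
    deriv (fun t => F.coframeInChart p a (t, y.2)) y.1 v
      = deriv (fun t => F.coframe a t ((extChartAt (𝓡 3) p).symm y.2)) y.1
        (chartSymmDeriv (𝓡 3) p y.2 v) :=
  congr($(deriv_formInChart hy.2) v)

omit hF in
theorem chartSymmDeriv_frameInChart (a : Fin 3) :
    chartSymmDeriv (𝓡 3) p y.2 (F.frameInChart p a y)
      = F.frame a y.1 ((extChartAt (𝓡 3) p).symm y.2) :=
  (isInvertible_chartSymmDeriv hy.2).self_apply_inverse _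

theorem isDualFrame_inChart : IsDualFrame (fun a => F.coframeInChart p a y)
    (fun a => F.frameInChart p a y) :=
  .of_finrank_eq_card (by simp) fun a c =>
    (congrArg (F.coframe a y.1 _) (chartSymmDeriv_frameInChart hy c)).trans
      ((hF.isDualFrame hy.1 _).apply_eq a c)

theorem ΘInChart_frameInChart_comm (hJ : IsOpen J) (a c : Fin 3) :
    F.ΘInChart p a y (F.frameInChart p c y) = F.ΘInChart p c y (F.frameInChart p a y) := by
  simp only [Family.ΘInChart, formInChart_apply, chartSymmDeriv_frameInChart hy]
  exact hF.Θ_comm hy.1 _ hJ _ _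

theorem ΘInChart_eq (hJ : IsOpen J) (a : Fin 3) : F.ΘInChart p a y
    = (-(1 / (2 * functionInChart p F.β y))) •
      (deriv (fun t => F.coframeInChart p a (t, y.2)) y.1
        + ∑ c, (deriv (fun t => F.coframeInChart p c (t, y.2)) y.1 (F.frameInChart p a y)) •
          F.coframeInChart p c y) := by
  ext v
  simp only [deriv_coframeInChart hy, chartSymmDeriv_frameInChart hy, smul_apply, add_apply,
    sum_apply, smul_eq_mul]
  exact hF.ΘOf_coframe hy.1 ((extChartAt (𝓡 3) p).symm y.2) hJ a (chartSymmDeriv (𝓡 3) p y.2 v)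

theorem dβInChart_eq (a : Fin 3) : F.dβInChart p a y
    = fderiv ℝ (fun x => functionInChart p F.β (y.1, x)) y.2 (F.frameInChart p a y) := by
  rw [hF.smooth_β.fderiv_functionInChart hy, formInChart_apply, chartSymmDeriv_frameInChart hy]
  rfl

end Pointwise

theorem contDiffOn_frameInChart (a : Fin 3) :
    ContDiffOn ℝ ∞ (F.frameInChart p a) (J ×ˢ (extChartAt (𝓡 3) p).target) :=
  contDiffOn_dualFrame (hF.contDiffOn_coframeInChart p) (fun _ hy => hF.isDualFrame_inChart hy) a

section Open

include hJ

theorem contDiffOn_ΘInChart (a : Fin 3) :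
    ContDiffOn ℝ ∞ (F.ΘInChart p a) (J ×ˢ (extChartAt (𝓡 3) p).target) := by
  have hU := hJ.prod (isOpen_extChartAt_target (I := 𝓡 3) p)
  have hβ := hF.smooth_β.contDiffOn_functionInChart p
  have he := hF.contDiffOn_coframeInChart p
  have he' (c : Fin 3) : ContDiffOn ℝ ∞
      (fun y => deriv (fun t => F.coframeInChart p c (t, y.2)) y.1)
      (J ×ˢ (extChartAt (𝓡 3) p).target) :=
    (((he c).fderiv_of_isOpen hU le_rfl).clm_apply contDiffOn_const).congr fun y hy =>
      deriv_prodMk_left (((he c).contDiffAt (hU.mem_nhds hy)).differentiableAt (by simp))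
  have hcoeff : ContDiffOn ℝ ∞ (fun y => -(1 / (2 * functionInChart p F.β y)))
      (J ×ˢ (extChartAt (𝓡 3) p).target) :=
    (contDiffOn_const.div (contDiffOn_const.mul hβ) fun y hy =>
      mul_ne_zero two_ne_zero (hF.β_pos _ hy.1 _).ne').neg
  exact (hcoeff.smul ((he' a).add (ContDiffOn.sum fun c _ =>
    ((he' c).clm_apply (hF.contDiffOn_frameInChart p a)).smul (he c)))).congr
    fun y hy => hF.ΘInChart_eq hy hJ a

theorem contDiffOn_dβInChart (a : Fin 3) :
    ContDiffOn ℝ ∞ (F.dβInChart p a) (J ×ˢ (extChartAt (𝓡 3) p).target) := by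
  have hU := hJ.prod (isOpen_extChartAt_target (I := 𝓡 3) p)
  have hβ := hF.smooth_β.contDiffOn_functionInChart p
  have hX := (contDiffOn_const (c := (0 : ℝ))).prodMk (hF.contDiffOn_frameInChart p a)
  refine ((hβ.fderiv_of_isOpen hU le_rfl).clm_apply hX).congr fun y hy => ?_
  rw [hF.dβInChart_eq hy, (hasFDerivAt_slice
    ((hβ.contDiffAt (hU.mem_nhds hy)).differentiableAt (by simp))).fderiv]
  rfl

end Open

section StructureEquations

variable {p} {y : ℝ × EuclideanSpace ℝ (Fin 3)} (hy : y ∈ J ×ˢ (extChartAt (𝓡 3) p).target)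
include hy

theorem fderiv_lapse_eq_sum : fderiv ℝ (fun x => functionInChart p F.β (y.1, x)) y.2
    = ∑ a, F.dβInChart p a y • F.coframeInChart p a y := by
  ext v
  rw [(hF.isDualFrame_inChart hy).covector_eq_sum _ v]
  simp only [hF.dβInChart_eq hy, sum_apply, smul_apply, smul_eq_mul]

theorem dForm_coframeInChart (a : Fin 3) (v w : EuclideanSpace ℝ (Fin 3)) :
    dForm (fun x => F.coframeInChart p a (y.1, x)) y.2 v w
      = extD (𝓡 3) (F.coframe a y.1) ((extChartAt (𝓡 3) p).symm y.2)
        (chartSymmDeriv (𝓡 3) p y.2 v) (chartSymmDeriv (𝓡 3) p y.2 w) :=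
  ((hF.smoothOneForms_coframe a).extD_chartSymmDeriv hy v w).symm

theorem deriv_coframeInChart_eu : deriv (fun t => F.coframeInChart p 0 (t, y.2)) y.1
    + F.dβInChart p 0 y • F.coframeInChart p 0 y + functionInChart p F.β y • F.ΘInChart p 0 y
      = ∑ a, F.dβInChart p a y • F.coframeInChart p a y
        + (lam * functionInChart p F.β y) • F.coframeInChart p 1 y := by
  rw [← hF.fderiv_lapse_eq_sum hy, hF.smooth_β.fderiv_functionInChart hy]
  ext v
  refine (congrArg (· + _ + _) (deriv_coframeInChart hy 0 v)).trans ?_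
  exact congr($(hF.evol_eu y.1 hy.1 ((extChartAt (𝓡 3) p).symm y.2))
    (chartSymmDeriv (𝓡 3) p y.2 v))

theorem deriv_coframeInChart_el : deriv (fun t => F.coframeInChart p 1 (t, y.2)) y.1
    + functionInChart p F.β y • F.ΘInChart p 1 y
      = -(F.dβInChart p 1 y + lam * functionInChart p F.β y) • F.coframeInChart p 0 y := by
  ext v
  refine (congrArg (· + _) (deriv_coframeInChart hy 1 v)).trans ?_
  exact congr($(hF.evol_el y.1 hy.1 ((extChartAt (𝓡 3) p).symm y.2))
    (chartSymmDeriv (𝓡 3) p y.2 v))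

theorem deriv_coframeInChart_en : deriv (fun t => F.coframeInChart p 2 (t, y.2)) y.1
    + functionInChart p F.β y • F.ΘInChart p 2 y
      = -F.dβInChart p 2 y • F.coframeInChart p 0 y := by
  ext v
  refine (congrArg (· + _) (deriv_coframeInChart hy 2 v)).trans ?_
  exact congr($(hF.evol_en y.1 hy.1 ((extChartAt (𝓡 3) p).symm y.2))
    (chartSymmDeriv (𝓡 3) p y.2 v))

theorem dForm_coframeInChart_eu : dForm (fun x => F.coframeInChart p 0 (y.1, x)) y.2
    = wedgeProd (F.ΘInChart p 0 y - lam • F.coframeInChart p 1 y) (F.coframeInChart p 0 y) := by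
  ext v w
  rw [hF.dForm_coframeInChart hy, wedgeProd_apply]
  exact hF.d_eu y.1 hy.1 ((extChartAt (𝓡 3) p).symm y.2) (chartSymmDeriv (𝓡 3) p y.2 v)
    (chartSymmDeriv (𝓡 3) p y.2 w)

theorem dForm_coframeInChart_el : dForm (fun x => F.coframeInChart p 1 (y.1, x)) y.2
    = wedgeProd (F.ΘInChart p 1 y) (F.coframeInChart p 0 y) := by
  ext v w
  rw [hF.dForm_coframeInChart hy, wedgeProd_apply]
  exact hF.d_el y.1 hy.1 ((extChartAt (𝓡 3) p).symm y.2) (chartSymmDeriv (𝓡 3) p y.2 v)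
    (chartSymmDeriv (𝓡 3) p y.2 w)

theorem dForm_coframeInChart_en : dForm (fun x => F.coframeInChart p 2 (y.1, x)) y.2
    + lam • wedgeProd (F.coframeInChart p 1 y) (F.coframeInChart p 2 y)
      = wedgeProd (F.ΘInChart p 2 y) (F.coframeInChart p 0 y) := by
  ext v w
  simp only [add_apply, smul_apply, hF.dForm_coframeInChart hy, wedgeProd_apply, smul_eq_mul]
  exact hF.d_en y.1 hy.1 ((extChartAt (𝓡 3) p).symm y.2) (chartSymmDeriv (𝓡 3) p y.2 v)
    (chartSymmDeriv (𝓡 3) p y.2 w)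

end StructureEquations

include hJ

theorem flowInCoordinates {f : ℝ → S → ℝ} (hf : IsPotential lam J F f) :
    FlowInCoordinates lam (functionInChart p F.β) (F.coframeInChart p) (F.frameInChart p)
      (F.ΘInChart p) (F.dβInChart p) (functionInChart p f) (J ×ˢ (extChartAt (𝓡 3) p).target) where
  isOpen := hJ.prod (isOpen_extChartAt_target p)
  smooth_β := (hF.smooth_β.contDiffOn_functionInChart p).of_le ENat.LEInfty.out
  smooth_e a := (hF.contDiffOn_coframeInChart p a).of_le ENat.LEInfty.out
  smooth_τ a := (hF.contDiffOn_ΘInChart p hJ a).of_le ENat.LEInfty.out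
  smooth_s a := (hF.contDiffOn_dβInChart p hJ a).of_le ENat.LEInfty.out
  smooth_f := (hf.smooth.contDiffOn_functionInChart p).of_le ENat.LEInfty.out
  β_ne y hy := (hF.β_pos _ hy.1 _).ne'
  dual _ hy := hF.isDualFrame_inChart hy
  τ_symm _ hy := hF.ΘInChart_frameInChart_comm hy hJ
  dβ _ hy := hF.fderiv_lapse_eq_sum hy
  evol_eu _ hy := hF.deriv_coframeInChart_eu hy
  evol_el _ hy := hF.deriv_coframeInChart_el hy
  evol_en _ hy := hF.deriv_coframeInChart_en hy
  d_eu _ hy := hF.dForm_coframeInChart_eu hy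
  d_el _ hy := hF.dForm_coframeInChart_el hy
  d_en _ hy := hF.dForm_coframeInChart_en hy
  df_space y hy := by
    rw [hf.smooth.fderiv_functionInChart hy]
    ext v
    exact congr($(hf.d_space y.1 hy.1 ((extChartAt (𝓡 3) p).symm y.2))
      (chartSymmDeriv (𝓡 3) p y.2 v))
  df_time y hy := hf.d_time y.1 hy.1 ((extChartAt (𝓡 3) p).symm y.2)

end InChart

end IsKillingSpinorialFlow

end FamilyFrames

/-! ### The Ricci tensor of the spacetime -/

section ProductCharts

variable {E : Type*} [NormedAddCommGroup E] [NormedSpace ℝ E] {H : Type*} [TopologicalSpace H]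
  {I : ModelWithCorners ℝ E H} {M : Type*} [TopologicalSpace M] [ChartedSpace H M]

theorem extChartAt_real_prod_symm_apply (t : ℝ) (p : M) (y : ℝ × E) :
    (extChartAt (𝓘(ℝ, ℝ).prod I) ((t, p) : ℝ × M)).symm y
      = (y.1, (extChartAt I p).symm y.2) := by
  rw [extChartAt_prod]
  rfl

theorem extChartAt_real_prod_apply (t : ℝ) (p : M) (q : ℝ × M) :
    extChartAt (𝓘(ℝ, ℝ).prod I) ((t, p) : ℝ × M) q = (q.1, extChartAt I p q.2) := by
  rw [extChartAt_prod]
  rfl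

theorem mem_extChartAt_target_real_prod (t : ℝ) (p : M) :
    (extChartAt (𝓘(ℝ, ℝ).prod I) ((t, p) : ℝ × M) (t, p)).2 ∈ (extChartAt I p).target := by
  rw [extChartAt_real_prod_apply]
  exact mem_extChartAt_target p

variable [I.Boundaryless] [IsManifold I 1 M]

theorem chartSymmDeriv_real_prod (t : ℝ) {p : M} {y : ℝ × E}
    (hy : y.2 ∈ (extChartAt I p).target) (v : ℝ × E) :
    chartSymmDeriv (𝓘(ℝ, ℝ).prod I) ((t, p) : ℝ × M) y v = (v.1, chartSymmDeriv I p y.2 v.2) := by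
  have hsymm : (extChartAt (𝓘(ℝ, ℝ).prod I) ((t, p) : ℝ × M)).symm
      = fun y : ℝ × E => (y.1, (extChartAt I p).symm y.2) :=
    funext (extChartAt_real_prod_symm_apply t p)
  have hspace : HasMFDerivAt 𝓘(ℝ, ℝ × E) I (fun y : ℝ × E => (extChartAt I p).symm y.2) y
      ((chartSymmDeriv I p y.2).comp (.snd ℝ ℝ E)) :=
    HasMFDerivAt.comp (I' := 𝓘(ℝ, E)) y (mdifferentiableAt_extChartAt_symm hy).hasMFDerivAt
      hasFDerivAt_snd.hasMFDerivAt
  have htime : HasMFDerivAt 𝓘(ℝ, ℝ × E) 𝓘(ℝ, ℝ) (Prod.fst : ℝ × E → ℝ) y (.fst ℝ ℝ E) :=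
    hasFDerivAt_fst.hasMFDerivAt
  have hprod := (htime.prodMk hspace).mfderiv
  rw [← hsymm] at hprod
  exact congrArg (fun L : ℝ × E →L[ℝ] ℝ × E => L v) hprod

end ProductCharts

section Spacetime

variable {S : Type*} [TopologicalSpace S] [ChartedSpace (EuclideanSpace ℝ (Fin 3)) S]

namespace Family

theorem dt_apply (q : ℝ × S) (v : ℝ × EuclideanSpace ℝ (Fin 3)) : dt q v = v.1 :=
  congrArg (fun L : ℝ × EuclideanSpace ℝ (Fin 3) →L[ℝ] ℝ => L v) mfderiv_fst

theorem lift_apply (q : ℝ × S) (α : EuclideanSpace ℝ (Fin 3) →L[ℝ] ℝ)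
    (v : ℝ × EuclideanSpace ℝ (Fin 3)) : lift q α v = α v.2 :=
  congrArg (fun L : ℝ × EuclideanSpace ℝ (Fin 3) →L[ℝ] EuclideanSpace ℝ (Fin 3) => α (L v))
    mfderiv_snd

variable (F : Family S)

theorem g_apply (q : ℝ × S) (v w : ℝ × EuclideanSpace ℝ (Fin 3)) : F.g q v w
    = -(F.β q.1 q.2 * v.1 * (F.β q.1 q.2 * w.1))
      + ∑ a, F.coframe a q.1 q.2 v.2 * F.coframe a q.1 q.2 w.2 := by
  have hg : F.g q v w = -(F.β q.1 q.2 ^ 2) * (dt q v * dt q w)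
      + lift q (F.coframe 0 q.1 q.2) v * lift q (F.coframe 0 q.1 q.2) w
      + lift q (F.coframe 1 q.1 q.2) v * lift q (F.coframe 1 q.1 q.2) w
      + lift q (F.coframe 2 q.1 q.2) v * lift q (F.coframe 2 q.1 q.2) w := rfl
  rw [hg, Fin.sum_univ_three]
  simp only [dt_apply, lift_apply]
  ring

theorem u_apply (f : ℝ → S → ℝ) (q : ℝ × S) (v : ℝ × EuclideanSpace ℝ (Fin 3)) : F.u f q v
    = Real.exp (f q.1 q.2) * (F.β q.1 q.2 * v.1 + F.coframe 0 q.1 q.2 v.2) := by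
  have hu : F.u f q v
      = Real.exp (f q.1 q.2) * (F.β q.1 q.2 * dt q v + lift q (F.coframe 0 q.1 q.2) v) := rfl
  rw [hu, dt_apply, lift_apply]

theorem metricInChart_h (t : ℝ) (p : S) (x : EuclideanSpace ℝ (Fin 3)) (i j : Fin 3) :
    metricInChart (𝓡 3) basis3 (F.h t) p x i j
      = ∑ a, F.coframeInChart p a (t, x) (basis3 i) * F.coframeInChart p a (t, x) (basis3 j) := by
  rw [metricInChart, Matrix.of_apply, h_eq_coframeMetric]
  exact coframeMetric_apply (E := EuclideanSpace ℝ (Fin 3))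
    (fun a => F.coframe a t ((extChartAt (𝓡 3) p).symm x)) _ _

variable [IsManifold (𝓡 3) ∞ S] {p : S}

section Chart

variable (t : ℝ) {y : ℝ × EuclideanSpace ℝ (Fin 3)} (hy : y.2 ∈ (extChartAt (𝓡 3) p).target)
include hy

theorem g_chartSymmDeriv (v w : ℝ × EuclideanSpace ℝ (Fin 3)) :
    F.g ((extChartAt (𝓘(ℝ, ℝ).prod (𝓡 3)) (t, p)).symm y)
        (chartSymmDeriv (𝓘(ℝ, ℝ).prod (𝓡 3)) (t, p) y v)
        (chartSymmDeriv (𝓘(ℝ, ℝ).prod (𝓡 3)) (t, p) y w)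
      = ∑ a, lorentzSign a * (lapseCoframe (functionInChart p F.β) (F.coframeInChart p) a y v
        * lapseCoframe (functionInChart p F.β) (F.coframeInChart p) a y w) := by
  refine (F.g_apply _ _ _).trans ?_
  rw [chartSymmDeriv_real_prod t hy, chartSymmDeriv_real_prod t hy,
    extChartAt_real_prod_symm_apply, Fintype.sum_sum_type]
  simp only [lorentzSign, Finset.univ_unique, Finset.sum_singleton, neg_one_mul, one_mul]
  rfl

theorem u_chartSymmDeriv (f : ℝ → S → ℝ) (v : ℝ × EuclideanSpace ℝ (Fin 3)) :
    F.u f ((extChartAt (𝓘(ℝ, ℝ).prod (𝓡 3)) (t, p)).symm y)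
        (chartSymmDeriv (𝓘(ℝ, ℝ).prod (𝓡 3)) (t, p) y v)
      = Real.exp (functionInChart p f y)
        * nullForm (functionInChart p F.β) (F.coframeInChart p) y v := by
  refine (F.u_apply f _ _).trans ?_
  rw [chartSymmDeriv_real_prod t hy, extChartAt_real_prod_symm_apply]
  rfl

end Chart

section Center

variable (t : ℝ) (p) (v w : ℝ × EuclideanSpace ℝ (Fin 3))

theorem g_eq_sum_lapseCoframe : F.g (t, p) v w
    = ∑ a, lorentzSign a
      * (lapseCoframe (functionInChart p F.β) (F.coframeInChart p) a
          (extChartAt (𝓘(ℝ, ℝ).prod (𝓡 3)) (t, p) (t, p))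
          (chartDeriv (𝓘(ℝ, ℝ).prod (𝓡 3)) (t, p) v)
        * lapseCoframe (functionInChart p F.β) (F.coframeInChart p) a
          (extChartAt (𝓘(ℝ, ℝ).prod (𝓡 3)) (t, p) (t, p))
          (chartDeriv (𝓘(ℝ, ℝ).prod (𝓡 3)) (t, p) w)) := by
  let g' (q : ℝ × S) (v w : ℝ × EuclideanSpace ℝ (Fin 3)) : ℝ := F.g q v w
  have hsource := mem_extChartAt_source (I := 𝓘(ℝ, ℝ).prod (𝓡 3)) ((t, p) : ℝ × S)
  have hchart := F.g_chartSymmDeriv t (mem_extChartAt_target_real_prod t p)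
    (chartDeriv (𝓘(ℝ, ℝ).prod (𝓡 3)) (t, p) v) (chartDeriv (𝓘(ℝ, ℝ).prod (𝓡 3)) (t, p) w)
  refine Eq.trans ?_ hchart
  change g' (t, p) v w = g' _ _ _
  congr 1
  · exact (extChartAt_to_inv _).symm
  · exact (chartSymmDeriv_mfderiv_extChartAt hsource v).symm
  · exact (chartSymmDeriv_mfderiv_extChartAt hsource w).symm

theorem u_eq_nullForm (f : ℝ → S → ℝ) : F.u f (t, p) v
    = Real.exp (f t p) * nullForm (functionInChart p F.β) (F.coframeInChart p)
      (extChartAt (𝓘(ℝ, ℝ).prod (𝓡 3)) (t, p) (t, p))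
      (chartDeriv (𝓘(ℝ, ℝ).prod (𝓡 3)) (t, p) v) := by
  let u' (q : ℝ × S) (v : ℝ × EuclideanSpace ℝ (Fin 3)) : ℝ := F.u f q v
  have hsource := mem_extChartAt_source (I := 𝓘(ℝ, ℝ).prod (𝓡 3)) ((t, p) : ℝ × S)
  have hchart := F.u_chartSymmDeriv t (mem_extChartAt_target_real_prod t p) f
    (chartDeriv (𝓘(ℝ, ℝ).prod (𝓡 3)) (t, p) v)
  rw [functionInChart, extChartAt_real_prod_apply, extChartAt_to_inv,
    ← extChartAt_real_prod_apply t p (t, p)] at hchart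
  refine Eq.trans ?_ hchart
  change u' (t, p) v = u' _ _
  congr 1
  · exact (extChartAt_to_inv _).symm
  · exact (chartSymmDeriv_mfderiv_extChartAt hsource v).symm

end Center

end Family

variable [IsManifold (𝓡 3) ∞ S] {lam : ℝ} {J : Set ℝ} {F : Family S}

namespace IsKillingSpinorialFlow

variable (hF : IsKillingSpinorialFlow lam J F) (hJ : IsOpen J) {f : ℝ → S → ℝ}
  (hf : IsPotential lam J F f) {t : ℝ} (ht : t ∈ J) (p : S)
include hF hJ hf ht

theorem two_mul_nullCoeff_eq_hamiltonian :
    2 * nullCoeff lam (functionInChart p F.β) (F.coframeInChart p) (F.frameInChart p)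
      (F.ΘInChart p) (F.dβInChart p) (t, extChartAt (𝓡 3) p p) = F.hamiltonian lam t p := by
  have hy : (t, extChartAt (𝓡 3) p p) ∈ J ×ˢ (extChartAt (𝓡 3) p).target :=
    ⟨ht, mem_extChartAt_target p⟩
  have hΘ (a c : Fin 3) :
      F.ΘInChart p a (t, extChartAt (𝓡 3) p p) (F.frameInChart p c (t, extChartAt (𝓡 3) p p))
        = F.ΘOf t p (F.coframe a t p) (F.frame c t p) := by
    rw [Family.ΘInChart, formInChart_apply, chartSymmDeriv_frameInChart hy]
    let Θ' (q : S) : ℝ := F.ΘOf t q (F.coframe a t q) (F.frame c t q)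
    exact congrArg Θ' (extChartAt_to_inv p)
  rw [(hF.flowInCoordinates p hJ hf).two_mul_nullCoeff hy basis3
    fun x _ => F.metricInChart_h t p x]
  simp only [hΘ, Family.hamiltonian, hF.traceWrt_eq_sum ht, hF.normSqWrt_eq_sum ht, scalarCurv]

theorem ricci_eq (v w : ℝ × EuclideanSpace ℝ (Fin 3)) :
    ricci (𝓘(ℝ, ℝ).prod (𝓡 3)) basis4 F.g (t, p) v w
      = -3 * lam ^ 2 * F.g (t, p) v w + 1 / 2 * F.hamiltonian lam t p * Real.exp (-2 * f t p)
          * (F.u f (t, p) v * F.u f (t, p) w) := by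
  have hflow := hF.flowInCoordinates p hJ hf
  have hy : extChartAt (𝓘(ℝ, ℝ).prod (𝓡 3)) (t, p) (t, p)
      ∈ J ×ˢ (extChartAt (𝓡 3) p).target := by
    rw [extChartAt_real_prod_apply]
    exact ⟨ht, mem_extChartAt_target p⟩
  have hricci := hflow.isLeviCivita.sum_ricciCoord_eq basis4
    (G := metricInChart (𝓘(ℝ, ℝ).prod (𝓡 3)) basis4 F.g (t, p))
    (fun y hy i j => F.g_chartSymmDeriv t hy.2 (basis4 i) (basis4 j)) hy
    (chartDeriv (𝓘(ℝ, ℝ).prod (𝓡 3)) (t, p) v) (chartDeriv (𝓘(ℝ, ℝ).prod (𝓡 3)) (t, p) w)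
  have hexp : Real.exp (-2 * f t p) * (Real.exp (f t p) * Real.exp (f t p)) = 1 := by
    rw [← Real.exp_add, ← Real.exp_add, ← Real.exp_zero]
    ring_nf
  refine hricci.trans ?_
  rw [hflow.sum_curvForm_mul hy, F.g_eq_sum_lapseCoframe p t v w, F.u_eq_nullForm p t v f,
    F.u_eq_nullForm p t w f, ← hF.two_mul_nullCoeff_eq_hamiltonian hJ hf ht p,
    extChartAt_real_prod_apply]
  linear_combination (-nullCoeff lam (functionInChart p F.β) (F.coframeInChart p)
    (F.frameInChart p) (F.ΘInChart p) (F.dβInChart p) (t, extChartAt (𝓡 3) p p)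
    * (nullForm (functionInChart p F.β) (F.coframeInChart p) (t, extChartAt (𝓡 3) p p)
        (chartDeriv (𝓘(ℝ, ℝ).prod (𝓡 3)) (t, p) v)
      * nullForm (functionInChart p F.β) (F.coframeInChart p) (t, extChartAt (𝓡 3) p p)
        (chartDeriv (𝓘(ℝ, ℝ).prod (𝓡 3)) (t, p) w))) * hexp

end IsKillingSpinorialFlow

end Spacetime

/-! ### The potential -/

section Primitive

open MeasureTheory Filter intervalIntegral
open scoped Interval

theorem exists_eventually_forall_norm_lt {X Y N : Type*} [TopologicalSpace X] [TopologicalSpace Y]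
    [SeminormedAddCommGroup N] {f : X × Y → N} {U : Set (X × Y)} (hf : ContinuousOn f U)
    (hU : IsOpen U) {K : Set X} (hK : IsCompact K) {y : Y} (hKU : ∀ x ∈ K, (x, y) ∈ U) :
    ∃ C, ∀ᶠ y' in 𝓝 y, ∀ x ∈ K, (x, y') ∈ U ∧ ‖f (x, y')‖ < C := by
  have hslice : ContinuousOn (fun x => f (x, y)) K := hf.comp (by fun_prop) hKU
  obtain ⟨C, hC⟩ := (hK.image_of_continuousOn hslice.norm).bddAbove
  refine ⟨C + 1, hK.eventually_forall_of_forall_eventually fun x hx => ?_⟩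
  have hnhds : U ∩ (fun z => ‖f z‖) ⁻¹' Iio (C + 1) ∈ 𝓝 (x, y) :=
    (hf.norm.isOpen_inter_preimage hU isOpen_Iio).mem_nhds
      ⟨hKU x hx, (hC ⟨x, hx, rfl⟩).trans_lt (lt_add_one C)⟩
  exact (continuous_swap.tendsto (y, x)).eventually hnhds

variable {G : Type*} [NormedAddCommGroup G] [NormedSpace ℝ G] {J : Set ℝ} (hJ : IsOpen J)
include hJ

theorem hasDerivAt_integral_right [CompleteSpace G] {X : Type*} [TopologicalSpace X] {W : Set X}
    {s : ℝ × X → G} (hs : ContinuousOn s (J ×ˢ W)) {t₀ t : ℝ} (hsub : [[t₀, t]] ⊆ J) {x : X}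
    (hx : x ∈ W) : HasDerivAt (fun r => ∫ z in t₀..r, s (z, x)) (s (t, x)) t := by
  have hslice : ContinuousOn (fun z => s (z, x)) J := hs.comp (by fun_prop) fun z hz => ⟨hz, hx⟩
  have ht : t ∈ J := hsub right_mem_uIcc
  exact integral_hasDerivAt_right (hslice.mono hsub).intervalIntegrable
    (hslice.stronglyMeasurableAtFilter hJ t ht) (hslice.continuousAt (hJ.mem_nhds ht))

variable {V : Type*} [NormedAddCommGroup V] [NormedSpace ℝ V] {W : Set V} (hW : IsOpen W)
  {s : ℝ × V → G} (hs : ContinuousOn s (J ×ˢ W)) {B : ℝ × V → V →L[ℝ] G}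
  (hB : ContinuousOn B (J ×ˢ W))
  (hsB : ∀ y ∈ J ×ˢ W, HasFDerivAt (fun x => s (y.1, x)) (B y) y.2)
include hW hs hB hsB

theorem hasFDerivAt_integral_param {t₀ t : ℝ} (hsub : [[t₀, t]] ⊆ J) {x : V} (hx : x ∈ W) :
    HasFDerivAt (fun x => ∫ z in t₀..t, s (z, x)) (∫ z in t₀..t, B (z, x)) x := by
  have hs_slice {x' : V} (hx' : x' ∈ W) : ContinuousOn (fun z => s (z, x')) [[t₀, t]] :=
    hs.comp (by fun_prop) fun z hz => ⟨hsub hz, hx'⟩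
  have hB_slice : ContinuousOn (fun z => B (z, x)) [[t₀, t]] :=
    hB.comp (by fun_prop) fun z hz => ⟨hsub hz, hx⟩
  obtain ⟨C, hC⟩ := exists_eventually_forall_norm_lt hB (hJ.prod hW) isCompact_uIcc
    fun z hz => ⟨hsub hz, hx⟩
  refine hasFDerivAt_integral_of_dominated_of_fderiv_le (F := fun x z => s (z, x))
    (F' := fun x z => B (z, x)) hC ?_ (hs_slice hx).intervalIntegrable
    ((hB_slice.mono uIoc_subset_uIcc).aestronglyMeasurable measurableSet_uIoc)
    (Eventually.of_forall fun z hz x' hx' => (hx' z (uIoc_subset_uIcc hz)).2.le)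
    intervalIntegrable_const
    (Eventually.of_forall fun z hz x' hx' => hsB _ (hx' z (uIoc_subset_uIcc hz)).1)
  filter_upwards [hW.mem_nhds hx] with x' hx'
  exact ((hs_slice hx').mono uIoc_subset_uIcc).aestronglyMeasurable measurableSet_uIoc

/-- The hypotheses `hsB` and `hAB` say that the `dt ∧ dx` part of `d(s dt + A)` vanishes. -/
theorem hasFDerivAt_primitive [CompleteSpace G] (hJ' : J.OrdConnected) {A : ℝ × V → V →L[ℝ] G}
    (hA : ContinuousOn A (J ×ˢ W))
    (hAB : ∀ y ∈ J ×ˢ W, HasDerivAt (fun t => A (t, y.2)) (B y) y.1) {t₀ : ℝ} (ht₀ : t₀ ∈ J)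
    {φ : V → G} (hφ : ∀ x ∈ W, HasFDerivAt φ (A (t₀, x)) x) {y : ℝ × V} (hy : y ∈ J ×ˢ W) :
    HasFDerivAt (fun y : ℝ × V => φ y.2 + ∫ z in t₀..y.1, s (z, y.2))
      ((ContinuousLinearMap.toSpanSingleton ℝ (s y)).coprod (A y)) y := by
  have hU : J ×ˢ W ∈ 𝓝 y := (hJ.prod hW).mem_nhds hy
  have hsub {t : ℝ} (ht : t ∈ J) : [[t₀, t]] ⊆ J := hJ'.uIcc_subset ht₀ ht
  refine (hasStrictFDerivAt_uncurry_coprod (𝕜 := ℝ) (u := y)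
    (f := fun t x => φ x + ∫ z in t₀..t, s (z, x))
    (f₁ := fun t x => ContinuousLinearMap.toSpanSingleton ℝ (s (t, x)))
    (f₂ := fun t x => A (t, x)) ?_ ?_ ?_ (hA.continuousAt hU)).hasFDerivAt
  · filter_upwards [hU] with y hy
    exact ((hasDerivAt_integral_right hJ hs (hsub hy.1) hy.2).const_add _).hasFDerivAt
  · filter_upwards [hU] with y hy
    have hspace := (hφ y.2 hy.2).add
      (hasFDerivAt_integral_param hJ hW hs hB hsB (hsub hy.1) hy.2)
    have hB_slice : ContinuousOn (fun z => B (z, y.2)) [[t₀, y.1]] :=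
      hB.comp (by fun_prop) fun z hz => ⟨hsub hy.1 hz, hy.2⟩
    rw [integral_eq_sub_of_hasDerivAt (f := fun z => A (z, y.2))
      (fun z hz => hAB (z, y.2) ⟨hsub hy.1 hz, hy.2⟩) hB_slice.intervalIntegrable,
      add_sub_cancel] at hspace
    exact hspace
  · exact (ContinuousLinearMap.toSpanSingletonCLE (𝕜 := ℝ) (E := G)).continuous.continuousAt.comp
      (hs.continuousAt hU)

end Primitive

section Potential

theorem exists_locallyConstant_baseTime {J : Set ℝ} (hJ : IsOpen J) :
    ∃ c : ℝ → ℝ, ∀ t ∈ J, ∃ K ⊆ J, IsOpen K ∧ K.OrdConnected ∧ t ∈ K ∧ c t ∈ K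
      ∧ ∀ r ∈ K, c r = c t := by
  classical
  let base (K : Set ℝ) : ℝ := if hK : K.Nonempty then hK.some else 0
  refine ⟨fun t => base (connectedComponentIn J t), fun t ht =>
    ⟨connectedComponentIn J t, connectedComponentIn_subset J t, hJ.connectedComponentIn,
      isPreconnected_connectedComponentIn.ordConnected, mem_connectedComponentIn ht, ?_,
      fun r hr => congrArg base (connectedComponentIn_eq hr).symm⟩⟩
  have hne : (connectedComponentIn J t).Nonempty := ⟨t, mem_connectedComponentIn ht⟩
  simp only [base, dif_pos hne, hne.some_mem]

variable {S : Type*} [TopologicalSpace S] [ChartedSpace (EuclideanSpace ℝ (Fin 3)) S]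
  {J : Set ℝ}

theorem SmoothFunctions.of_contDiffOn_functionInChart (hJ : IsOpen J)
    {f : ℝ → S → ℝ}
    (hf : ∀ p, ContDiffOn ℝ ∞ (functionInChart p f) (J ×ˢ (extChartAt (𝓡 3) p).target)) :
    SmoothFunctions J f := by
  rintro ⟨t, p⟩ ⟨ht, -⟩
  have hcoord : ContMDiffAt (𝓘(ℝ, ℝ).prod (𝓡 3)) 𝓘(ℝ, ℝ × EuclideanSpace ℝ (Fin 3)) ∞
      (fun q : ℝ × S => (q.1, extChartAt (𝓡 3) p q.2)) (t, p) :=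
    contMDiffAt_fst.prodMk_space
      (ContMDiffAt.comp (t, p) (contMDiffAt_extChartAt (x := p)) contMDiffAt_snd)
  have hchart : ContMDiffAt 𝓘(ℝ, ℝ × EuclideanSpace ℝ (Fin 3)) 𝓘(ℝ, ℝ) ∞
      (functionInChart p f) (t, extChartAt (𝓡 3) p p) :=
    ((hf p).contDiffAt (prod_mem_nhds (hJ.mem_nhds ht) (extChartAt_target_mem_nhds p))).contMDiffAt
  refine ((ContMDiffAt.comp (t, p) hchart hcoord).congr_of_eventuallyEq ?_).contMDiffWithinAt
  filter_upwards [prod_mem_nhds Filter.univ_mem (extChartAt_source_mem_nhds (I := 𝓡 3) p)]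
    with q hq
  simp only [Function.comp_apply, functionInChart, (extChartAt (𝓡 3) p).left_inv hq.2]

variable {lam : ℝ} {F : Family S}

namespace Family

variable (F lam) in
/-- The one-forms `-Θ_t(e_u) - λ e_l`, which are the spatial differentials of a potential. -/
def potentialForm (t : ℝ) (q : S) : TangentSpace (𝓡 3) q →L[ℝ] ℝ :=
  -F.ΘOf t q (F.eu t q) - lam • F.el t q

end Family

variable [IsManifold (𝓡 3) ∞ S]

namespace IsKillingSpinorialFlow

variable (hF : IsKillingSpinorialFlow lam J F) (hJ : IsOpen J)
include hF hJ

theorem contDiffOn_potentialForm (p : S) : ContDiffOn ℝ ∞ (formInChart p (F.potentialForm lam))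
    (J ×ˢ (extChartAt (𝓡 3) p).target) :=
  (hF.contDiffOn_ΘInChart p hJ 0).neg.sub ((hF.contDiffOn_coframeInChart p 1).const_smul lam)

theorem hasDerivAt_potentialForm {p : S} {y : ℝ × EuclideanSpace ℝ (Fin 3)}
    (hy : y ∈ J ×ˢ (extChartAt (𝓡 3) p).target) :
    HasDerivAt (fun t => formInChart p (F.potentialForm lam) (t, y.2))
      ((fderiv ℝ (F.dβInChart p 0) y).comp (.inr ℝ ℝ (EuclideanSpace ℝ (Fin 3)))) y.1 := by
  have hU := (hJ.prod (isOpen_extChartAt_target (I := 𝓡 3) p)).mem_nhds hy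
  have hsmooth := SmoothFunctions.of_contDiffOn_functionInChart hJ
    fun p => hF.contDiffOn_dβInChart p hJ 0
  have hdβ := hsmooth.fderiv_functionInChart hy
  have hspace := hasFDerivAt_slice
    (((hF.contDiffOn_dβInChart p hJ 0).contDiffAt hU).differentiableAt (by simp))
  have htime {α : ℝ × EuclideanSpace ℝ (Fin 3) → EuclideanSpace ℝ (Fin 3) →L[ℝ] ℝ}
      (hα : ContDiffOn ℝ ∞ α (J ×ˢ (extChartAt (𝓡 3) p).target)) :
      HasDerivAt (fun t => α (t, y.2)) (deriv (fun t => α (t, y.2)) y.1) y.1 :=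
    (((hα.contDiffAt hU).differentiableAt (by simp)).comp y.1
      (by fun_prop : DifferentiableAt ℝ (fun t => (t, y.2)) y.1)).hasDerivAt
  refine ((htime (hF.contDiffOn_ΘInChart p hJ 0)).neg.sub
    ((htime (hF.contDiffOn_coframeInChart p 1)).const_smul lam)).congr_deriv ?_
  rw [← hspace.fderiv]
  refine Eq.trans ?_ hdβ.symm
  ext v
  have hΘ := congr($(deriv_formInChart (α := fun t q => F.ΘOf t q (F.eu t q)) hy.2) v)
  have hevol : (_ + lam * _ : ℝ) = -_ :=
    congr($(hF.evol_Θ y.1 hy.1 ((extChartAt (𝓡 3) p).symm y.2)) (chartSymmDeriv (𝓡 3) p y.2 v))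
  have hel := deriv_coframeInChart (F := F) hy 1 v
  refine Eq.trans (congrArg₂ (fun a b : ℝ => -a - lam * b) hΘ hel) ?_
  exact (neg_add' _ _).symm.trans (neg_eq_iff_eq_neg.2 hevol)

theorem isPotential_of_hasFDerivAt {f : ℝ → S → ℝ}
    (hf : ∀ p, ∀ y ∈ J ×ˢ (extChartAt (𝓡 3) p).target, HasFDerivAt (functionInChart p f)
      ((ContinuousLinearMap.toSpanSingleton ℝ (F.dβInChart p 0 y)).coprod
        (formInChart p (F.potentialForm lam) y)) y) : IsPotential lam J F f := by
  have hsmooth : SmoothFunctions J f := .of_contDiffOn_functionInChart hJ fun p => by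
    rw [contDiffOn_infty_iff_fderiv_of_isOpen (hJ.prod (isOpen_extChartAt_target p))]
    refine ⟨fun y hy => (hf p y hy).differentiableAt.differentiableWithinAt, ?_⟩
    have htime := ContinuousLinearMap.toSpanSingletonCLE (𝕜 := ℝ) (E := ℝ)
      |>.contDiff.comp_contDiffOn (hF.contDiffOn_dβInChart p hJ 0)
    have hspace := hF.contDiffOn_potentialForm hJ p
    exact ((htime.clm_comp contDiffOn_const).add (hspace.clm_comp contDiffOn_const)).congr
      fun y hy => (hf p y hy).fderiv.trans (ContinuousLinearMap.comp_fst_add_comp_snd _ _).symm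
  have hchart {t : ℝ} (ht : t ∈ J) (p : S) :
      (t, extChartAt (𝓡 3) p p) ∈ J ×ˢ (extChartAt (𝓡 3) p).target :=
    ⟨ht, mem_extChartAt_target p⟩
  refine ⟨hsmooth, fun t ht p => ?_, fun t ht p => ?_⟩
  · have hspace := hsmooth.fderiv_functionInChart (hchart ht p)
    rw [(hasFDerivAt_slice (hf p _ (hchart ht p)).differentiableAt).fderiv,
      (hf p _ (hchart ht p)).fderiv, ContinuousLinearMap.coprod_comp_inr] at hspace
    exact (eq_of_chartForm_eq hspace).symm
  · have htime := deriv_prodMk_left (hf p _ (hchart ht p)).differentiableAt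
    rw [(hf p _ (hchart ht p)).fderiv] at htime
    simp only [ContinuousLinearMap.coprod_apply, ContinuousLinearMap.toSpanSingleton_apply,
      one_smul, map_zero, add_zero, functionInChart, Family.dβInChart] at htime
    rwa [extChartAt_to_inv] at htime

theorem exists_isPotential : ∃ f : ℝ → S → ℝ, IsPotential lam J F f := by
  obtain ⟨c, hc⟩ := exists_locallyConstant_baseTime hJ
  choose! φ hφ_smooth hφ using hF.exact_form
  let f (t : ℝ) (q : S) : ℝ := -φ (c t) q + ∫ r in c t..t, F.dβOf r q (F.eu r q)
  refine ⟨f, hF.isPotential_of_hasFDerivAt hJ fun p y hy => ?_⟩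
  obtain ⟨K, hKJ, hK, hK', hyK, hcK, hcK'⟩ := hc y.1 hy.1
  have hV := isOpen_extChartAt_target (I := 𝓡 3) p
  have hU := hK.prod hV
  have hsub : K ×ˢ (extChartAt (𝓡 3) p).target ⊆ J ×ˢ (extChartAt (𝓡 3) p).target :=
    prod_mono hKJ subset_rfl
  have hdβ := (hF.contDiffOn_dβInChart p hJ 0).mono hsub
  have hφ' : ∀ x ∈ (extChartAt (𝓡 3) p).target,
      HasFDerivAt (fun x => -φ (c y.1) ((extChartAt (𝓡 3) p).symm x))
        (formInChart p (F.potentialForm lam) (c y.1, x)) x := by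
    intro x hx
    have hφx := ((hφ_smooth _ (hKJ hcK)).mdifferentiable (by simp))
      ((extChartAt (𝓡 3) p).symm x)
    refine (hasFDerivAt_comp_extChartAt_symm hx hφx).neg.congr_fderiv ?_
    ext v
    have hexact := congr(-$(hφ _ (hKJ hcK) ((extChartAt (𝓡 3) p).symm x))
      (chartSymmDeriv (𝓡 3) p x v))
    exact hexact.trans (neg_add' _ _)
  refine (hasFDerivAt_primitive hK hV hdβ.continuousOn
    (B := fun y => (fderiv ℝ (F.dβInChart p 0) y).comp (.inr ℝ ℝ _))
    (((hdβ.fderiv_of_isOpen hU le_rfl).clm_comp contDiffOn_const).continuousOn (n := ∞))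
    (fun y hy => hasFDerivAt_slice
      ((hdβ.contDiffAt (hU.mem_nhds hy)).differentiableAt (by simp)))
    hK' ((hF.contDiffOn_potentialForm hJ p).mono hsub).continuousOn
    (fun y hy => hF.hasDerivAt_potentialForm hJ (hsub hy)) hcK hφ'
    ⟨hyK, hy.2⟩).congr_of_eventuallyEq ?_
  filter_upwards [hU.mem_nhds ⟨hyK, hy.2⟩] with z hz
  simp only [functionInChart, f, hcK' z.1 hz.1]
  rfl

end IsKillingSpinorialFlow

end Potential

end KillingFlow

end

open KillingFlow in
theorem mainTheorem8_general {S : Type*} [TopologicalSpace S]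
    [ChartedSpace (EuclideanSpace ℝ (Fin 3)) S] [IsManifold (𝓡 3) ∞ S]
    (lam : ℝ) (J : Set ℝ) (hJ : IsOpen J) (F : Family S) (hF : IsKillingSpinorialFlow lam J F) :
    (∃ f : ℝ → S → ℝ, IsPotential lam J F f) ∧
    ∀ f : ℝ → S → ℝ, IsPotential lam J F f →
      ∀ t ∈ J, ∀ p : S, ∀ X Y : TangentSpace (𝓘(ℝ, ℝ).prod (𝓡 3)) ((t, p) : ℝ × S),
        ricci (𝓘(ℝ, ℝ).prod (𝓡 3)) basis4 F.g (t, p) X Y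
          = -3 * lam ^ 2 * F.g (t, p) X Y
            + 1 / 2 * F.hamiltonian lam t p * Real.exp (-2 * f t p)
              * (F.u f (t, p) X * F.u f (t, p) Y) :=
  ⟨hF.exists_isPotential hJ, fun _ hf _ ht p X Y => hF.ricci_eq hJ hf ht p X Y⟩

open KillingFlow in
theorem mainTheorem8 {S : Type*} [TopologicalSpace S] [T2Space S] [SecondCountableTopology S]
    [ChartedSpace (EuclideanSpace ℝ (Fin 3)) S] [IsManifold (𝓡 3) ∞ S]
    (lam : ℝ) (J : Set ℝ) (hJ : IsOpen J) (hJ' : J.OrdConnected)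
    (F : Family S) (hF : IsKillingSpinorialFlow lam J F) :
    (∃ f : ℝ → S → ℝ, IsPotential lam J F f) ∧
    ∀ f : ℝ → S → ℝ, IsPotential lam J F f →
      ∀ t ∈ J, ∀ p : S, ∀ X Y : TangentSpace (𝓘(ℝ, ℝ).prod (𝓡 3)) ((t, p) : ℝ × S),
        ricci (𝓘(ℝ, ℝ).prod (𝓡 3)) basis4 F.g (t, p) X Y
          = -3 * lam ^ 2 * F.g (t, p) X Y
            + 1 / 2 * F.hamiltonian lam t p * Real.exp (-2 * f t p)
              * (F.u f (t, p) X * F.u f (t, p) Y) :=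
  mainTheorem8_general lam J hJ F hF
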